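/- **Theorem (Syntactic Soundness).** Let $\Gamma$ be a consistent top-level type environment, let $\mathcal M$ be a module with $\vdash \mathcal M : \Gamma$, and let $M$ be a closed term of the language below. (1) If $\Gamma \vdash M : \mathsf{Ok}$ ($M$ is well-typed in $\Gamma$), then $M$ does not go wrong. (2) If $\Gamma,\, M : \mathsf{Ok} \vdash$ ($M$ is ill-typed in $\Gamma$), then $M$ does not evaluate. The notions are as follows. *Language.* Fix a finite signature of constructors $c$ with arities $n_c$, containing a binary pair constructor. Terms, up to renaming of bound variables, are $$M,N,P ::= x \mid \mathsf f \mid c(M_1,\dots,M_{n_c}) \mid M\,N \mid \lambda x.M \mid \mathsf{fix}\,x.M \mid \mathsf{match}\ M\ \mathsf{with}\ |_{c\in I}\,(c(x_{c,1},\dots,x_{c,n_c}) \mapsto P_c),$$ with $x$ a local variable, $\mathsf f$ a top-level identifier, $I$ a finite set of constructors, and all pattern variables distinct. A term is closed if it has no free local variables. Values are variables, abstractions, and constructors applied to values. A module $\mathcal M$ is a finite sequence of definitions of distinct top-level identifiers by closed terms. Reduction $\rhd$ is the closure of $\mathsf f \rhd \mathcal M(\mathsf f)$; $(\lambda x.M)\,V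 \rhd M[V/x]$; $\mathsf{fix}\,x.M \rhd M[\mathsf{fix}\,x.M/x]$; $\mathsf{match}\ c(\bar V)\ \mathsf{with}\ |_{d\in I}(d(\bar x_d)\mapsto P_d) \rhd P_c[\bar V/\bar x_c]$ for $c\in I$ (with $V$, $\bar V$ values) under the contexts $\mathcal E ::= \square \mid c(\bar V,\mathcal E,\bar M) \mid \mathcal E\,N \mid (\lambda x.M)\,\mathcal E \mid \mathsf{match}\ \mathcal E\ \mathsf{with}\ \cdots$. A term *evaluates* if it reduces in zero or more steps to a value; it *goes wrong* if it reduces in zero or more steps to a term that is not a value and cannot make a step. *Types.* Monotypes are $A,B ::= a \mid K \mid \mathsf{Ok} \mid A\to B \mid A \rightarrowtail B$, with $a$ a type variable and $K=\Sigma_{c\in I}\,c(A_{c,1},\dots,A_{c,n_c})$ a sum over a finite set $I$ of constructors. Constraints are $A\sqsubseteq B$. Type schemes are closed and have the shape $A$ or $\forall\bar a.\,C\Rightarrow A$, with $C$ a finite set of constraints. Subtyping $C\vdash A\sqsubseteq B$ is the least relation that contains $C$, is transitive, has $A\sqsubseteq\mathsf{Ok}$, and is closed under: $A'\sqsubseteq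 A,\ B\sqsubseteq B' \Rightarrow A\to B\sqsubseteq A'\to B'$; $A\sqsubseteq A',\ B'\sqsubseteq B \Rightarrow A\rightarrowtail B\sqsubseteq A'\rightarrowtail B'$; and, for $I\subseteq J$, $A_{c,i}\sqsubseteq B_{c,i}$ for all $c\in I$ and $i\le n_c$ $\Rightarrow$ $\Sigma_{c\in I}c(\bar A_c)\sqsubseteq\Sigma_{c\in J}c(\bar B_c)$. *Judgements.* $\Gamma\vdash\Delta$, where $\Gamma$ is a finite set of formulas $M:A$, $\mathsf f:S$ ($S$ a type scheme) and $A\sqsubseteq B$, and $\Delta$ contains at most one formula $M:A$. Write $\mathsf{Con}(\Gamma)$ for the set of constraints in $\Gamma$, and $\Gamma\vdash A\sqsubseteq B$ for $\mathsf{Con}(\Gamma)\vdash A\sqsubseteq B$. The rules (premises $\Rightarrow$ conclusion; bound variables are chosen fresh) are: - $\Gamma\vdash x:\mathsf{Ok}$; $\ \Gamma,x:A\vdash x:A$; $\ \Gamma,\mathsf f:\forall\bar a.C\Rightarrow A\vdash \mathsf f:A[\bar B/\bar a]$ if $\Gamma\vdash C[\bar B/\bar a]$ (a scheme that is a monotype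 counts as $\forall\emptyset.\emptyset\Rightarrow A$). - If $\Gamma\vdash A\sqsubseteq B$: $\ \Gamma,M:B\vdash\Delta\Rightarrow\Gamma,M:A\vdash\Delta$. If $\Gamma\vdash B\sqsubseteq A$: $\ \Gamma\vdash M:B\Rightarrow\Gamma\vdash M:A$. - $\Gamma,x:B\vdash M:A\Rightarrow\Gamma\vdash\lambda x.M:B\to A$; $\ \Gamma,M:A\vdash x:B\Rightarrow\Gamma\vdash\lambda x.M:B\rightarrowtail A$. - $\Gamma\vdash M:B\rightarrowtail A$ and $\Gamma,N:B\vdash\Delta\Rightarrow\Gamma,M\,N:A\vdash\Delta$; $\ \Gamma\vdash M:B\to A$ and $\Gamma\vdash N:B\Rightarrow\Gamma\vdash M\,N:A$. - $\Gamma,M_i:A_i\vdash\Delta$ for some $i$ $\Rightarrow\Gamma,c(\bar M):K\vdash\Delta$ if $c(\bar A)$ is a summand of $K$; $\ \Gamma\vdash M_i:A_i$ for all $i$ $\Rightarrow\Gamma\vdash c(\bar M):c(\bar A)$. - $\Gamma\vdash M:\Sigma_{c\in I}c(\bar B_c)$ and, for all $c\in I$, $\Gamma\cup\{x_{c,j}:B_{c,j}\mid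 j\le n_c\}\vdash P_c:A$ $\Rightarrow\Gamma\vdash\mathsf{match}\ M\ \mathsf{with}\ |_{c\in I}(c(\bar x_c)\mapsto P_c):A$. - $\Gamma,P_c:A\vdash x_{c,j}:B_{c,j}$ for all $c\in I$, $j\le n_c$, and $\Gamma,(M,P_c):(c(\bar B_c),A)\vdash\Delta$ for all $c\in I$ $\Rightarrow\Gamma,\mathsf{match}\ M\ \mathsf{with}\ |_{c\in I}(c(\bar x_c)\mapsto P_c):A\vdash\Delta$. - $\Gamma,x:A\vdash M:A\Rightarrow\Gamma\vdash\mathsf{fix}\,x.M:A$; $\ \Gamma,M_i:\mathsf{Ok}\vdash\Delta$ for some $i$ $\Rightarrow\Gamma,c(\bar M):\mathsf{Ok}\vdash\Delta$; $\ \Gamma,M:\mathsf{Ok}\rightarrowtail A\vdash\Delta\Rightarrow\Gamma,M\,N:\mathsf{Ok}\vdash\Delta$. - $\Gamma,c(\bar M):A\vdash\Delta$ if $A$ is an arrow of either kind or a sum without a $c$-summand; $\ \Gamma,\lambda x.M:K\vdash\Delta$ for every sum type $K$. *Environments.* A top-level type environment is a finite set of constraints and identifier typings $\mathsf f:S$ with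 at most one scheme for each $\mathsf f$. It is *consistent* if $C=\mathsf{Con}(\Gamma)$ satisfies: (a) $A\sqsubseteq A'\in C$ and $A'\sqsubseteq B\in C$ imply $A\sqsubseteq B\in C$; (b) if $K\sqsubseteq K'\in C$, $c(\bar A)$ is a summand of $K$ and $c(\bar B)$ is a summand of $K'$, then all $A_i\sqsubseteq B_i\in C$; (c) $A\to B\sqsubseteq A'\to B'\in C$ implies $A'\sqsubseteq A,\ B\sqsubseteq B'\in C$; (d) $A\rightarrowtail B\sqsubseteq A'\rightarrowtail B'\in C$ implies $A\sqsubseteq A',\ B'\sqsubseteq B\in C$; and (e) for each $A\sqsubseteq B\in C$, $A$ or $B$ is a type variable, or $A,B$ are arrows of the same kind, or $B=\mathsf{Ok}$, or $A=\Sigma_{c\in I}\cdots$ and $B=\Sigma_{d\in J}\cdots$ with $I\subseteq J$. Finally, $\vdash\mathcal M:\Gamma$ means that every identifier defined in $\mathcal M$ is a subject of $\Gamma$ and that, for each $\mathsf f:\forall\bar a.C\Rightarrow A$ in $\Gamma$, $\mathcal M(\mathsf f)$ is defined, $\bar a$ are exactly the type variables of $C$ and $A$, the bound variables $\bar a$ are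 distinct from the type variables occurring in $\mathsf{Con}(\Gamma)$, and $\Gamma\cup C\vdash\mathcal M(\mathsf f):A$. -/

import Mathlib

namespace TwoSided

/-! ### Signatures, types and type schemes -/

/-- A finite signature of ranked datatype constructors, with a distinguished binary pair
constructor. -/
structure Signature where
  Con : Type
  finite_con : Finite Con
  arity : Con → ℕ
  pair : Con
  arity_pair : arity pair = 2

/-- Monotypes.  `sum I A` is the sum type `Σ_{c ∈ I} c(A_{c,1}, …, A_{c,n_c})`: indexing the summands
by the finite set `I` of their head constructors makes the heads pairwise distinct.  `arr A B` is
the sufficiency arrow (`A` to `B`) and `nec A B` is the necessity arrow (`A` only to `B`). -/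
inductive Ty (S : Signature) : Type
  | var (a : ℕ) : Ty S
  | sum (I : Finset S.Con) (A : (c : {c // c ∈ I}) → Fin (S.arity c.1) → Ty S) : Ty S
  | ok : Ty S
  | arr (A B : Ty S) : Ty S
  | nec (A B : Ty S) : Ty S

namespace Ty

variable {S : Signature}

/-- The type variables of a monotype. -/
def fv : Ty S → Set ℕ
  | var a => {a}
  | sum _ A => ⋃ c, ⋃ i, (A c i).fv
  | ok => ∅
  | arr A B => A.fv ∪ B.fv
  | nec A B => A.fv ∪ B.fv

/-- Simultaneous substitution of types for type variables. -/
def subst (σ : ℕ → Ty S) : Ty S → Ty S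
  | var a => σ a
  | sum I A => sum I (fun c i => (A c i).subst σ)
  | ok => ok
  | arr A B => arr (A.subst σ) (B.subst σ)
  | nec A B => nec (A.subst σ) (B.subst σ)

/-- The one-summand type `c(B_{c,1}, …, B_{c,n})` taken from a family of types indexed by `I`. -/
def single {I : Finset S.Con} (B : (c : {c // c ∈ I}) → Fin (S.arity c.1) → Ty S)
    (c : {c // c ∈ I}) : Ty S :=
  sum {c.1} (fun d => B ⟨d.1, (Finset.mem_singleton.mp d.2).symm ▸ c.2⟩)

/-- The pair type `(A, B)`, a one-summand sum headed by the pair constructor. -/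
def pair (A B : Ty S) : Ty S :=
  sum {S.pair} (fun _ i => if i.val = 0 then A else B)

end Ty

/-- A type constraint: `(A, B)` stands for `A ⊑ B`. -/
abbrev Constr (S : Signature) : Type := Ty S × Ty S

/-- The type variables of a set of constraints. -/
def constrFv {S : Signature} (C : Set (Constr S)) : Set ℕ :=
  ⋃ p ∈ C, p.1.fv ∪ p.2.fv

/-- A type scheme `∀ vars. constrs ⇒ body`.  Schemes are closed. -/
structure Scheme (S : Signature) : Type where
  vars : Finset ℕ
  constrs : Finset (Constr S)
  body : Ty S
  closed : constrFv (constrs : Set (Constr S)) ∪ body.fv ⊆ (vars : Set ℕ)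

/-- A closed monotype, regarded as a type scheme. -/
def Scheme.mono {S : Signature} (A : Ty S) (h : A.fv = ∅) : Scheme S where
  vars := ∅
  constrs := ∅
  body := A
  closed := by simp [constrFv, h]

/-! ### Constrained subtyping -/

/-- Derivability of the subtyping judgement `C ⊢ A ⊑ B`. -/
inductive Sub {S : Signature} (C : Set (Constr S)) : Ty S → Ty S → Prop
  | id {A B : Ty S} : (A, B) ∈ C → Sub C A B
  | trans {A₁ A₂ A₃ : Ty S} : Sub C A₁ A₂ → Sub C A₂ A₃ → Sub C A₁ A₃
  | arr {A A' B B' : Ty S} : Sub C A' A → Sub C B B' → Sub C (.arr A B) (.arr A' B')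
  | nec {A A' B B' : Ty S} : Sub C A A' → Sub C B' B → Sub C (.nec A B) (.nec A' B')
  | ok {A : Ty S} : Sub C A .ok
  | sum {I J : Finset S.Con} (hIJ : I ⊆ J)
      {A : (c : {c // c ∈ I}) → Fin (S.arity c.1) → Ty S}
      {B : (c : {c // c ∈ J}) → Fin (S.arity c.1) → Ty S} :
      (∀ (c : {c // c ∈ I}) (i : Fin (S.arity c.1)), Sub C (A c i) (B ⟨c.1, hIJ c.2⟩ i)) →
      Sub C (.sum I A) (.sum J B)

/-- Closed constraint sets. -/
structure ClosedConstr {S : Signature} (C : Set (Constr S)) : Prop where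
  trans : ∀ A A' B : Ty S, (A, A') ∈ C → (A', B) ∈ C → (A, B) ∈ C
  sum : ∀ (I J : Finset S.Con) (A : (c : {c // c ∈ I}) → Fin (S.arity c.1) → Ty S)
      (B : (c : {c // c ∈ J}) → Fin (S.arity c.1) → Ty S),
      (Ty.sum I A, Ty.sum J B) ∈ C →
      ∀ (c : S.Con) (hI : c ∈ I) (hJ : c ∈ J) (i : Fin (S.arity c)),
        (A ⟨c, hI⟩ i, B ⟨c, hJ⟩ i) ∈ C
  arr : ∀ A B A' B' : Ty S, (Ty.arr A B, Ty.arr A' B') ∈ C → (A', A) ∈ C ∧ (B, B') ∈ C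
  nec : ∀ A B A' B' : Ty S, (Ty.nec A B, Ty.nec A' B') ∈ C → (A, A') ∈ C ∧ (B', B) ∈ C

/-- Syntactic consistency of a constraint `A ⊑ B`. -/
inductive SynConsistent {S : Signature} : Ty S → Ty S → Prop
  | varL (a : ℕ) (B : Ty S) : SynConsistent (.var a) B
  | varR (A : Ty S) (b : ℕ) : SynConsistent A (.var b)
  | arr (A B A' B' : Ty S) : SynConsistent (.arr A B) (.arr A' B')
  | nec (A B A' B' : Ty S) : SynConsistent (.nec A B) (.nec A' B')
  | ok (A : Ty S) : SynConsistent A .ok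
  | sum {I J : Finset S.Con} (hIJ : I ⊆ J)
      (A : (c : {c // c ∈ I}) → Fin (S.arity c.1) → Ty S)
      (B : (c : {c // c ∈ J}) → Fin (S.arity c.1) → Ty S) :
      SynConsistent (.sum I A) (.sum J B)

/-- Consistent constraint sets. -/
def ConsistentConstr {S : Signature} (C : Set (Constr S)) : Prop :=
  ClosedConstr C ∧ ∀ A B : Ty S, (A, B) ∈ C → SynConsistent A B

/-! ### Terms

Terms up to renaming of bound variables are represented by well-scoped nameless terms: `Term S n`
is the type of terms whose free local variables are among `n` given ones, so that `Term S 0` is the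
type of closed terms.  A binder of `m` variables takes a body in `Term S (n + m)`, in which
`Fin.castAdd m i` is the old variable `i` and `Fin.natAdd n j` is the `j`-th bound variable. -/

/-- Terms.  `glob f` is a top-level identifier, and `mtch M I P` is the pattern match
`match M with |_{c ∈ I} (c(x_{c,1}, …, x_{c,n_c}) ↦ P c)`. -/
inductive Term (S : Signature) : ℕ → Type
  | var {n : ℕ} (x : Fin n) : Term S n
  | glob {n : ℕ} (f : ℕ) : Term S n
  | con {n : ℕ} (c : S.Con) (M : Fin (S.arity c) → Term S n) : Term S n
  | app {n : ℕ} (M N : Term S n) : Term S n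
  | lam {n : ℕ} (M : Term S (n + 1)) : Term S n
  | fix {n : ℕ} (M : Term S (n + 1)) : Term S n
  | mtch {n : ℕ} (M : Term S n) (I : Finset S.Con)
      (P : (c : {c // c ∈ I}) → Term S (n + S.arity c.1)) : Term S n

/-- Extend a renaming over `m` bound variables. -/
def liftRen {n k : ℕ} (ρ : Fin n → Fin k) (m : ℕ) : Fin (n + m) → Fin (k + m) :=
  Fin.addCases (fun i => Fin.castAdd m (ρ i)) (fun j => Fin.natAdd k j)

namespace Term

variable {S : Signature}

/-- Renaming of free variables. -/
def ren : {n k : ℕ} → (Fin n → Fin k) → Term S n → Term S k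
  | _, _, ρ, var x => var (ρ x)
  | _, _, _, glob f => glob f
  | _, _, ρ, con c M => con c (fun i => (M i).ren ρ)
  | _, _, ρ, app M N => app (M.ren ρ) (N.ren ρ)
  | _, _, ρ, lam M => lam (M.ren (liftRen ρ 1))
  | _, _, ρ, fix M => fix (M.ren (liftRen ρ 1))
  | _, _, ρ, mtch M I P => mtch (M.ren ρ) I (fun c => (P c).ren (liftRen ρ (S.arity c.1)))

/-- Weakening by `m` fresh variables. -/
def wk {n : ℕ} (m : ℕ) (M : Term S n) : Term S (n + m) := M.ren (Fin.castAdd m)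

/-- Extend a substitution over `m` bound variables. -/
def liftSubst {n k : ℕ} (θ : Fin n → Term S k) (m : ℕ) : Fin (n + m) → Term S (k + m) :=
  Fin.addCases (fun i => (θ i).wk m) (fun j => var (Fin.natAdd k j))

/-- Simultaneous capture-avoiding substitution. -/
def subst : {n k : ℕ} → (Fin n → Term S k) → Term S n → Term S k
  | _, _, θ, var x => θ x
  | _, _, _, glob f => glob f
  | _, _, θ, con c M => con c (fun i => (M i).subst θ)
  | _, _, θ, app M N => app (M.subst θ) (N.subst θ)
  | _, _, θ, lam M => lam (M.subst (liftSubst θ 1))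
  | _, _, θ, fix M => fix (M.subst (liftSubst θ 1))
  | _, _, θ, mtch M I P => mtch (M.subst θ) I (fun c => (P c).subst (liftSubst θ (S.arity c.1)))

/-- `M[V₁/x₁, …, Vₘ/xₘ]` for the `m` most recently bound variables. -/
def inst {n m : ℕ} (M : Term S (n + m)) (V : Fin m → Term S n) : Term S n :=
  M.subst (Fin.addCases var V)

/-- The pair `(M, N)`. -/
def pair {n : ℕ} (M N : Term S n) : Term S n :=
  con S.pair (fun i => if i.val = 0 then M else N)

end Term

/-! ### Reduction -/

/-- Values: variables, abstractions, and constructors applied to values. -/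
inductive Value {S : Signature} {n : ℕ} : Term S n → Prop
  | var (x : Fin n) : Value (.var x)
  | lam (M : Term S (n + 1)) : Value (.lam M)
  | con (c : S.Con) (V : Fin (S.arity c) → Term S n) : (∀ i, Value (V i)) → Value (.con c V)

/-- A module: a finite sequence of definitions `f = M` of distinct top-level identifiers by closed
terms (which may mention top-level identifiers). -/
abbrev Program (S : Signature) : Type := AList (fun _ : ℕ => Term S 0)

/-- One-step reduction with respect to a module: the closure of (Delta), (Beta), (Fix) and (Match)
under the evaluation contexts
`□ | c(V₁, …, E, …, Mₙ) | E N | (λx. M) E | match E with …`. -/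
inductive Step {S : Signature} (P : Program S) {n : ℕ} : Term S n → Term S n → Prop
  | delta {f : ℕ} {M : Term S 0} : P.lookup f = some M → Step P (.glob f) (M.ren Fin.elim0)
  | beta {M : Term S (n + 1)} {V : Term S n} :
      Value V → Step P (.app (.lam M) V) (M.inst (fun _ => V))
  | fix {M : Term S (n + 1)} : Step P (.fix M) (M.inst (fun _ => .fix M))
  | mtch {I : Finset S.Con} {Q : (c : {c // c ∈ I}) → Term S (n + S.arity c.1)}
      (c : {c // c ∈ I}) {V : Fin (S.arity c.1) → Term S n} :
      (∀ i, Value (V i)) → Step P (.mtch (.con c.1 V) I Q) ((Q c).inst V)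
  | conCtx {c : S.Con} {M : Fin (S.arity c) → Term S n} (i : Fin (S.arity c)) {N : Term S n} :
      (∀ j, j < i → Value (M j)) → Step P (M i) N →
      Step P (.con c M) (.con c (Function.update M i N))
  | appCtxL {M M' N : Term S n} : Step P M M' → Step P (.app M N) (.app M' N)
  | appCtxR {M : Term S (n + 1)} {N N' : Term S n} :
      Step P N N' → Step P (.app (.lam M) N) (.app (.lam M) N')
  | mtchCtx {M M' : Term S n} {I : Finset S.Con}
      {Q : (c : {c // c ∈ I}) → Term S (n + S.arity c.1)} :
      Step P M M' → Step P (.mtch M I Q) (.mtch M' I Q)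

/-- Reflexive-transitive closure of one-step reduction. -/
def Steps {S : Signature} (P : Program S) {n : ℕ} : Term S n → Term S n → Prop :=
  Relation.ReflTransGen (Step P)

/-- A stuck term is a normal form that is not a value. -/
def Stuck {S : Signature} (P : Program S) {n : ℕ} (M : Term S n) : Prop :=
  (¬ ∃ N, Step P M N) ∧ ¬ Value M

/-- A term goes wrong if it reduces to a stuck term. -/
def GoesWrong {S : Signature} (P : Program S) {n : ℕ} (M : Term S n) : Prop :=
  ∃ N, Steps P M N ∧ Stuck P N

/-- A term evaluates if it reduces to a value. -/
def Evaluates {S : Signature} (P : Program S) {n : ℕ} (M : Term S n) : Prop :=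
  ∃ V, Steps P M V ∧ Value V

/-! ### Two-sided constrained type assignment -/

/-- Typing formulas `M : A`, identifier typings `f : ∀ ā. C ⇒ A`, and subtype formulas `A ⊑ B`,
in a scope of `n` local variables. -/
inductive Formula (S : Signature) (n : ℕ) : Type
  | typing (M : Term S n) (A : Ty S)
  | ident (f : ℕ) (T : Scheme S)
  | sub (A B : Ty S)

/-- Weakening a formula by `m` fresh local variables. -/
def Formula.wk {S : Signature} {n : ℕ} (m : ℕ) : Formula S n → Formula S (n + m)
  | .typing M A => .typing (M.wk m) A
  | .ident f T => .ident f T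
  | .sub A B => .sub A B

/-- The left-hand side `Γ` of a judgement, a set of formulas. -/
abbrev Env (S : Signature) (n : ℕ) : Type := Set (Formula S n)

/-- The right-hand side `Δ` of a judgement: at most one typing formula `M : A`. -/
abbrev Concl (S : Signature) (n : ℕ) : Type := Option (Term S n × Ty S)

/-- `Γ` in a scope extended by `m` fresh local variables, which do not occur in it. -/
def Env.wk {S : Signature} {n : ℕ} (m : ℕ) (Γ : Env S n) : Env S (n + m) :=
  Formula.wk m '' Γ

/-- `Δ` in a scope extended by `m` fresh local variables, which do not occur in it. -/
def Concl.wk {S : Signature} {n : ℕ} (m : ℕ) (Δ : Concl S n) : Concl S (n + m) :=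
  Δ.map (fun p => (p.1.wk m, p.2))

/-- `Con(Γ)`, the subtype formulas of `Γ`. -/
def Env.constrs {S : Signature} {n : ℕ} (Γ : Env S n) : Set (Constr S) :=
  {p | Formula.sub p.1 p.2 ∈ Γ}

/-- `f : T` is a formula of `Γ`.  A closed monotype is a type scheme, so `f : A` may also occur as
a formula of shape `M : A` whose subject is the identifier `f`. -/
def Env.HasIdent {S : Signature} {n : ℕ} (Γ : Env S n) (f : ℕ) (T : Scheme S) : Prop :=
  Formula.ident f T ∈ Γ ∨
    ∃ (A : Ty S) (h : A.fv = ∅), T = Scheme.mono A h ∧ Formula.typing (.glob f) A ∈ Γ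

/-- Derivability of `Γ ⊢ Δ`.  `insert (.typing M A) Γ` is `Γ, M : A`.  In `gvar`, since the scheme is
closed, applying `σ` to its constraints and body is the instantiation of its quantified variables. -/
inductive Der {S : Signature} : {n : ℕ} → Env S n → Concl S n → Prop
  -- structural rules
  | varK {n : ℕ} {Γ : Env S n} (x : Fin n) : Der Γ (some (.var x, .ok))
  | gvar {n : ℕ} {Γ : Env S n} {f : ℕ} {T : Scheme S} (σ : ℕ → Ty S) :
      Γ.HasIdent f T →
      (∀ p ∈ T.constrs, Sub Γ.constrs (p.1.subst σ) (p.2.subst σ)) →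
      Der Γ (some (.glob f, T.body.subst σ))
  | lvar {n : ℕ} {Γ : Env S n} {x : Fin n} {A : Ty S} :
      Formula.typing (.var x) A ∈ Γ → Der Γ (some (.var x, A))
  | subL {n : ℕ} {Γ : Env S n} {Δ : Concl S n} {M : Term S n} {A B : Ty S} :
      Sub Γ.constrs A B →
      Der (insert (.typing M B) Γ) Δ → Der (insert (.typing M A) Γ) Δ
  | subR {n : ℕ} {Γ : Env S n} {M : Term S n} {A B : Ty S} :
      Sub Γ.constrs B A → Der Γ (some (M, B)) → Der Γ (some (M, A))
  -- functions
  | absR {n : ℕ} {Γ : Env S n} {M : Term S (n + 1)} {A B : Ty S} :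
      Der (insert (.typing (.var (Fin.natAdd n 0)) B) (Γ.wk 1)) (some (M, A)) →
      Der Γ (some (.lam M, .arr B A))
  | abnR {n : ℕ} {Γ : Env S n} {M : Term S (n + 1)} {A B : Ty S} :
      Der (insert (.typing M A) (Γ.wk 1)) (some (.var (Fin.natAdd n 0), B)) →
      Der Γ (some (.lam M, .nec B A))
  | appL {n : ℕ} {Γ : Env S n} {Δ : Concl S n} {M N : Term S n} {A B : Ty S} :
      Der Γ (some (M, .nec B A)) → Der (insert (.typing N B) Γ) Δ →
      Der (insert (.typing (.app M N) A) Γ) Δ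
  | appR {n : ℕ} {Γ : Env S n} {M N : Term S n} {A B : Ty S} :
      Der Γ (some (M, .arr B A)) → Der Γ (some (N, B)) → Der Γ (some (.app M N, A))
  -- constructors
  | cnsL {n : ℕ} {Γ : Env S n} {Δ : Concl S n} {c : S.Con} {M : Fin (S.arity c) → Term S n}
      {I : Finset S.Con} {A : (c : {c // c ∈ I}) → Fin (S.arity c.1) → Ty S}
      (hc : c ∈ I) (i : Fin (S.arity c)) :
      Der (insert (.typing (M i) (A ⟨c, hc⟩ i)) Γ) Δ →
      Der (insert (.typing (.con c M) (.sum I A)) Γ) Δ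
  | cnsR {n : ℕ} {Γ : Env S n} {c : S.Con} {M : Fin (S.arity c) → Term S n}
      {A : (d : {d // d ∈ ({c} : Finset S.Con)}) → Fin (S.arity d.1) → Ty S} :
      (∀ i, Der Γ (some (M i, A ⟨c, Finset.mem_singleton_self c⟩ i))) →
      Der Γ (some (.con c M, .sum {c} A))
  -- pattern matching
  | mchR {n : ℕ} {Γ : Env S n} {M : Term S n} {I : Finset S.Con}
      {P : (c : {c // c ∈ I}) → Term S (n + S.arity c.1)} {A : Ty S}
      {B : (c : {c // c ∈ I}) → Fin (S.arity c.1) → Ty S} :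
      Der Γ (some (M, .sum I B)) →
      (∀ c : {c // c ∈ I},
        Der (Γ.wk (S.arity c.1) ∪
          Set.range (fun i => Formula.typing (.var (Fin.natAdd n i)) (B c i))) (some (P c, A))) →
      Der Γ (some (.mtch M I P, A))
  | mchL {n : ℕ} {Γ : Env S n} {Δ : Concl S n} {M : Term S n} {I : Finset S.Con}
      {P : (c : {c // c ∈ I}) → Term S (n + S.arity c.1)} {A : Ty S}
      {B : (c : {c // c ∈ I}) → Fin (S.arity c.1) → Ty S} :
      (∀ (c : {c // c ∈ I}) (i : Fin (S.arity c.1)),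
        Der (insert (.typing (P c) A) (Γ.wk (S.arity c.1)))
          (some (.var (Fin.natAdd n i), B c i))) →
      (∀ c : {c // c ∈ I},
        Der (insert (.typing (.pair (M.wk (S.arity c.1)) (P c)) (.pair (.single B c) A))
          (Γ.wk (S.arity c.1))) (Δ.wk (S.arity c.1))) →
      Der (insert (.typing (.mtch M I P) A) Γ) Δ
  -- fixpoints and evaluation
  | fixR {n : ℕ} {Γ : Env S n} {M : Term S (n + 1)} {A : Ty S} :
      Der (insert (.typing (.var (Fin.natAdd n 0)) A) (Γ.wk 1)) (some (M, A)) →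
      Der Γ (some (.fix M, A))
  | cnsK {n : ℕ} {Γ : Env S n} {Δ : Concl S n} {c : S.Con} {M : Fin (S.arity c) → Term S n}
      (i : Fin (S.arity c)) :
      Der (insert (.typing (M i) .ok) Γ) Δ → Der (insert (.typing (.con c M) .ok) Γ) Δ
  | funK {n : ℕ} {Γ : Env S n} {Δ : Concl S n} {M N : Term S n} {A : Ty S} :
      Der (insert (.typing M (.nec .ok A)) Γ) Δ → Der (insert (.typing (.app M N) .ok) Γ) Δ
  -- disjointness
  | cnsDArr {n : ℕ} {Γ : Env S n} {Δ : Concl S n} {c : S.Con}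
      {M : Fin (S.arity c) → Term S n} {A B : Ty S} :
      Der (insert (.typing (.con c M) (.arr A B)) Γ) Δ
  | cnsDNec {n : ℕ} {Γ : Env S n} {Δ : Concl S n} {c : S.Con}
      {M : Fin (S.arity c) → Term S n} {A B : Ty S} :
      Der (insert (.typing (.con c M) (.nec A B)) Γ) Δ
  | cnsDSum {n : ℕ} {Γ : Env S n} {Δ : Concl S n} {c : S.Con}
      {M : Fin (S.arity c) → Term S n} {I : Finset S.Con}
      {A : (c : {c // c ∈ I}) → Fin (S.arity c.1) → Ty S} :
      c ∉ I → Der (insert (.typing (.con c M) (.sum I A)) Γ) Δ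
  | absD {n : ℕ} {Γ : Env S n} {Δ : Concl S n} {M : Term S (n + 1)} {I : Finset S.Con}
      {A : (c : {c // c ∈ I}) → Fin (S.arity c.1) → Ty S} :
      Der (insert (.typing (.lam M) (.sum I A)) Γ) Δ

/-! ### Type environments, justified modules, well-typing and ill-typing -/

/-- Top-level type environments: finite sets of subtype formulas and identifier typings, with at
most one type scheme for each identifier. -/
structure TopLevelEnv {S : Signature} (Γ : Env S 0) : Prop where
  finite : Γ.Finite
  shape : ∀ φ ∈ Γ,
    (∃ A B, φ = .sub A B) ∨ (∃ f T, φ = .ident f T) ∨ (∃ f A, A.fv = ∅ ∧ φ = .typing (.glob f) A)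
  unique : ∀ f T T', Γ.HasIdent f T → Γ.HasIdent f T' → T = T'

/-- A type environment is consistent if its set of subtype formulas is. -/
def ConsistentEnv {S : Signature} {n : ℕ} (Γ : Env S n) : Prop :=
  ConsistentConstr Γ.constrs

/-- `Γ ⊢ f : ∀ ā. C ⇒ A` for a top-level definition `f = M`: the quantified variables are exactly
those of `C` and `A`, as bound variables they are distinct from the type variables that are free in
`Γ`, and `Γ ∪ C ⊢ M : A`. -/
structure JustifiedIdent {S : Signature} (P : Program S) (Γ : Env S 0) (f : ℕ) (T : Scheme S) :
    Prop where
  vars_eq : (T.vars : Set ℕ) = constrFv (T.constrs : Set (Constr S)) ∪ T.body.fv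
  fresh : Disjoint (T.vars : Set ℕ) (constrFv Γ.constrs)
  der : ∃ M, P.lookup f = some M ∧
    Der (Γ ∪ {φ | ∃ p ∈ T.constrs, φ = Formula.sub p.1 p.2}) (some (M, T.body))

/-- `⊢ P : Γ`: every identifier that `P` defines is a subject of `Γ`, and every identifier typing
in `Γ` is justified. -/
structure JustifiedProgram {S : Signature} (P : Program S) (Γ : Env S 0) : Prop where
  covers : ∀ f, f ∈ P → ∃ T, Γ.HasIdent f T
  justified : ∀ f T, Γ.HasIdent f T → JustifiedIdent P Γ f T

/-- `M` is well-typed in `Γ`: `Γ ⊢ M : Ok`. -/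
def WellTyped {S : Signature} (Γ : Env S 0) (M : Term S 0) : Prop :=
  Der Γ (some (M, .ok))

/-- `M` is ill-typed in `Γ`: `Γ, M : Ok ⊢`. -/
def IllTyped {S : Signature} (Γ : Env S 0) (M : Term S 0) : Prop :=
  Der (insert (.typing M .ok) Γ) none

end TwoSided

namespace TwoSided

variable {S : Signature}

/-! ### Renaming and substitution -/

/-! The proof is a step-indexed logical relation in which the two sides of a judgement are read
differently. On the right, `M : A` means `Safe`: for a given number of steps `M` does not get stuck,
and a value reached has type `A` as far as can be observed. On the left, `M : A` means that `M` does
evaluate, to a value with `Refl` at `A` (`EvalsTo`). `Refl` sees only constructors and the fact of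
being an abstraction, so it needs no step index. It implies membership of `A` at every level
(`Refl.val`), so left assumptions entail right conclusions.

Left assumptions are existential and cannot be weakened to fewer steps, while right conclusions can.
Hence a global bound `K` stays fixed, and each variable carries its own bound: a claim about a term
is made only up to the bounds of its free variables (`Below`). Variables bound by a sufficiency
rule, pattern variables of the right match rule and `fix` variables carry typings valid up to their
bound. Variables bound by a necessity rule stand for values, and a typing concluded for one of them
must hold in the sense of `Refl`; this is the second half of `SatConcl`, and it is what the left
rules for application and match consume.

Inverting value typings at arrows and sums requires that derived subtyping between proper types
follow their outer shapes. This is where consistency of the constraints enters (`Sub.factors`,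
`Factors.structSub`). Every rule then preserves truth (`Der.satConcl`). Identifiers are safe at
their types by induction on the level, because unfolding a definition costs a step
(`JustifiedProgram.safe`).

For a well-typed term this gives safety at every level, so no stuck term is reachable. If an
ill-typed term evaluated, its typing at `Ok` would be a true left assumption with an empty, hence
false, right-hand side. -/

@[simp] theorem liftRen_castAdd {n k : ℕ} (ρ : Fin n → Fin k) (m : ℕ) (i : Fin n) :
    liftRen ρ m (Fin.castAdd m i) = Fin.castAdd m (ρ i) := by simp [liftRen]

@[simp] theorem liftRen_natAdd {n k : ℕ} (ρ : Fin n → Fin k) (m : ℕ) (j : Fin m) :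
    liftRen ρ m (Fin.natAdd n j) = Fin.natAdd k j := by simp [liftRen]

namespace Term

@[simp] theorem liftSubst_castAdd {n k : ℕ} (θ : Fin n → Term S k) (m : ℕ) (i : Fin n) :
    liftSubst θ m (Fin.castAdd m i) = (θ i).wk m := by simp [liftSubst]

@[simp] theorem liftSubst_natAdd {n k : ℕ} (θ : Fin n → Term S k) (m : ℕ) (j : Fin m) :
    liftSubst θ m (Fin.natAdd n j) = var (Fin.natAdd k j) := by simp [liftSubst]

/-- Extend a substitution by terms for `m` further variables. -/
def ext {n m k : ℕ} (θ : Fin n → Term S k) (V : Fin m → Term S k) : Fin (n + m) → Term S k :=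
  Fin.addCases θ V

@[simp] theorem ext_castAdd {n m k : ℕ} (θ : Fin n → Term S k) (V : Fin m → Term S k) (i : Fin n) :
    ext θ V (Fin.castAdd m i) = θ i := by simp [ext]

@[simp] theorem ext_natAdd {n m k : ℕ} (θ : Fin n → Term S k) (V : Fin m → Term S k) (j : Fin m) :
    ext θ V (Fin.natAdd n j) = V j := by simp [ext]

theorem ren_ren {n k l : ℕ} (M : Term S n) (ρ : Fin n → Fin k) (ρ' : Fin k → Fin l) :
    (M.ren ρ).ren ρ' = M.ren (ρ' ∘ ρ) := by
  have lift : ∀ {n k l : ℕ} (ρ : Fin n → Fin k) (ρ' : Fin k → Fin l) (m : ℕ),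
      liftRen ρ' m ∘ liftRen ρ m = liftRen (ρ' ∘ ρ) m := by
    intro n k l ρ ρ' m
    funext x
    refine Fin.addCases (fun i => ?_) (fun j => ?_) x <;> simp
  induction M generalizing k l with
  | var x => rfl
  | glob f => rfl
  | con c M ih => simp [ren, ih]
  | app M N ihM ihN => simp [ren, ihM, ihN]
  | lam M ih => simp [ren, ih, lift]
  | fix M ih => simp [ren, ih, lift]
  | mtch M I Q ihM ihQ => simp [ren, ihM, ihQ, lift]

theorem subst_ren {n k l : ℕ} (M : Term S n) (ρ : Fin n → Fin k) (θ : Fin k → Term S l) :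
    (M.ren ρ).subst θ = M.subst (θ ∘ ρ) := by
  have lift : ∀ {n k l : ℕ} (ρ : Fin n → Fin k) (θ : Fin k → Term S l) (m : ℕ),
      liftSubst θ m ∘ liftRen ρ m = liftSubst (θ ∘ ρ) m := by
    intro n k l ρ θ m
    funext x
    refine Fin.addCases (fun i => ?_) (fun j => ?_) x <;> simp
  induction M generalizing k l with
  | var x => rfl
  | glob f => rfl
  | con c M ih => simp [ren, subst, ih]
  | app M N ihM ihN => simp [ren, subst, ihM, ihN]
  | lam M ih => simp [ren, subst, ih, lift]
  | fix M ih => simp [ren, subst, ih, lift]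
  | mtch M I Q ihM ihQ => simp [ren, subst, ihM, ihQ, lift]

theorem ren_subst {n k l : ℕ} (M : Term S n) (θ : Fin n → Term S k) (ρ : Fin k → Fin l) :
    (M.subst θ).ren ρ = M.subst (fun i => (θ i).ren ρ) := by
  have lift : ∀ {n k l : ℕ} (θ : Fin n → Term S k) (ρ : Fin k → Fin l) (m : ℕ),
      (fun i => (liftSubst θ m i).ren (liftRen ρ m)) = liftSubst (fun i => (θ i).ren ρ) m := by
    intro n k l θ ρ m
    funext x
    refine Fin.addCases (fun i => ?_) (fun j => ?_) x
    · simp only [liftSubst_castAdd, wk, ren_ren]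
      congr 1
      funext y
      simp
    · simp [ren]
  induction M generalizing k l with
  | var x => rfl
  | glob f => rfl
  | con c M ih => simp [ren, subst, ih]
  | app M N ihM ihN => simp [ren, subst, ihM, ihN]
  | lam M ih => simp [ren, subst, ih, lift]
  | fix M ih => simp [ren, subst, ih, lift]
  | mtch M I Q ihM ihQ => simp [ren, subst, ihM, ihQ, lift]

theorem subst_subst {n k l : ℕ} (M : Term S n) (θ : Fin n → Term S k) (φ : Fin k → Term S l) :
    (M.subst θ).subst φ = M.subst (fun i => (θ i).subst φ) := by
  have lift : ∀ {n k l : ℕ} (θ : Fin n → Term S k) (φ : Fin k → Term S l) (m : ℕ),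
      (fun i => (liftSubst θ m i).subst (liftSubst φ m)) =
        liftSubst (fun i => (θ i).subst φ) m := by
    intro n k l θ φ m
    funext x
    refine Fin.addCases (fun i => ?_) (fun j => ?_) x
    · simp only [liftSubst_castAdd, wk, subst_ren, ren_subst]
      congr 1
      funext y
      simp [wk]
    · simp [subst]
  induction M generalizing k l with
  | var x => rfl
  | glob f => rfl
  | con c M ih => simp [subst, ih]
  | app M N ihM ihN => simp [subst, ihM, ihN]
  | lam M ih => simp [subst, ih, lift]
  | fix M ih => simp [subst, ih, lift]
  | mtch M I Q ihM ihQ => simp [subst, ihM, ihQ, lift]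

theorem ren_id {n : ℕ} (M : Term S n) : M.ren id = M := by
  have lift : ∀ n m : ℕ, liftRen (id : Fin n → Fin n) m = id := by
    intro n m
    funext x
    refine Fin.addCases (fun i => ?_) (fun j => ?_) x <;> simp
  induction M with
  | var x => rfl
  | glob f => rfl
  | con c M ih => simp [ren, ih]
  | app M N ihM ihN => simp [ren, ihM, ihN]
  | lam M ih => simp [ren, ih, lift]
  | fix M ih => simp [ren, ih, lift]
  | mtch M I Q ihM ihQ => simp [ren, ihM, ihQ, lift]

theorem subst_var {n : ℕ} (M : Term S n) : M.subst var = M := by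
  have lift : ∀ n m : ℕ, liftSubst (var : Fin n → Term S n) m = var := by
    intro n m
    funext x
    refine Fin.addCases (fun i => ?_) (fun j => ?_) x <;> simp [wk, ren]
  induction M with
  | var x => rfl
  | glob f => rfl
  | con c M ih => simp [subst, ih]
  | app M N ihM ihN => simp [subst, ihM, ihN]
  | lam M ih => simp [subst, ih, lift]
  | fix M ih => simp [subst, ih, lift]
  | mtch M I Q ihM ihQ => simp [subst, ihM, ihQ, lift]

theorem ren_closed (M : Term S 0) (ρ : Fin 0 → Fin 0) : M.ren ρ = M := by
  rw [Subsingleton.elim ρ id, ren_id]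

theorem subst_closed (M : Term S 0) (θ : Fin 0 → Term S 0) : M.subst θ = M := by
  rw [Subsingleton.elim θ var, subst_var]

theorem wk_subst_ext {n m k : ℕ} (M : Term S n) (θ : Fin n → Term S k) (V : Fin m → Term S k) :
    (M.wk m).subst (ext θ V) = M.subst θ := by
  rw [wk, subst_ren]
  congr 1
  funext i
  simp

/-- Instantiating a binder after closing its body is closing the body by the extended substitution.
This lets a reduct be read as an instance of the premise of a binding rule. -/
theorem inst_subst_liftSubst {n m k : ℕ} (M : Term S (n + m)) (θ : Fin n → Term S k)
    (V : Fin m → Term S k) : (M.subst (liftSubst θ m)).inst V = M.subst (ext θ V) := by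
  rw [inst, subst_subst]
  congr 1
  funext x
  refine Fin.addCases (fun i => ?_) (fun j => ?_) x
  · rw [liftSubst_castAdd, ext_castAdd]
    exact (wk_subst_ext (θ i) var V).trans (subst_var _)
  · simp [subst]

/-! ### Predicates on free variables -/

/-- Extend a predicate on variables to `m` bound variables, on which it holds. -/
def liftPred {n : ℕ} (p : Fin n → Prop) (m : ℕ) : Fin (n + m) → Prop :=
  Fin.addCases p (fun _ => True)

/-- All free variables satisfy `p`. -/
def FVAll : {n : ℕ} → (Fin n → Prop) → Term S n → Prop
  | _, p, var x => p x
  | _, _, glob _ => True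
  | _, p, con _ M => ∀ i, FVAll p (M i)
  | _, p, app M N => FVAll p M ∧ FVAll p N
  | _, p, lam M => FVAll (liftPred p 1) M
  | _, p, fix M => FVAll (liftPred p 1) M
  | _, p, mtch M _ P => FVAll p M ∧ ∀ c, FVAll (liftPred p _) (P c)

theorem liftPred_imp {n m : ℕ} {p : Fin n → Prop} {q : Fin (n + m) → Prop}
    (h : ∀ i, p i → q (Fin.castAdd m i)) (h' : ∀ j, q (Fin.natAdd n j)) :
    ∀ x, liftPred p m x → q x := by
  intro x
  refine Fin.addCases (fun i => ?_) (fun j => ?_) x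
  · simpa [liftPred] using h i
  · exact fun _ => h' j

theorem FVAll.mono {n : ℕ} {M : Term S n} {p q : Fin n → Prop} (h : FVAll p M)
    (hpq : ∀ x, p x → q x) : FVAll q M := by
  have lift : ∀ {n : ℕ} {p q : Fin n → Prop} (m : ℕ), (∀ x, p x → q x) →
      ∀ x, liftPred p m x → liftPred q m x := fun m h =>
    liftPred_imp (fun i hi => by simpa [liftPred] using h i hi) (fun j => by simp [liftPred])
  induction M with
  | var x => exact hpq x h
  | glob f => trivial
  | con c M ih => exact fun i => ih i (h i) hpq
  | app M N ihM ihN => exact ⟨ihM h.1 hpq, ihN h.2 hpq⟩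
  | lam M ih => exact ih h (lift _ hpq)
  | fix M ih => exact ih h (lift _ hpq)
  | mtch M I Q ihM ihQ => exact ⟨ihM h.1 hpq, fun c => ihQ c (h.2 c) (lift _ hpq)⟩

theorem FVAll.ren {n k : ℕ} {M : Term S n} {ρ : Fin n → Fin k} {p : Fin n → Prop}
    {q : Fin k → Prop} (h : FVAll p M) (hpq : ∀ x, p x → q (ρ x)) : FVAll q (M.ren ρ) := by
  have lift : ∀ {n k : ℕ} {ρ : Fin n → Fin k} {p : Fin n → Prop} {q : Fin k → Prop} (m : ℕ),
      (∀ x, p x → q (ρ x)) → ∀ x, liftPred p m x → liftPred q m (liftRen ρ m x) := fun m h =>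
    liftPred_imp (fun i hi => by simpa [liftPred] using h i hi) (fun j => by simp [liftPred])
  induction M generalizing k with
  | var x => exact hpq x h
  | glob f => trivial
  | con c M ih => exact fun i => ih i (h i) hpq
  | app M N ihM ihN => exact ⟨ihM h.1 hpq, ihN h.2 hpq⟩
  | lam M ih => exact ih h (lift _ hpq)
  | fix M ih => exact ih h (lift _ hpq)
  | mtch M I Q ihM ihQ => exact ⟨ihM h.1 hpq, fun c => ihQ c (h.2 c) (lift _ hpq)⟩

theorem FVAll.of_forall {n : ℕ} {M : Term S n} {p : Fin n → Prop} (hp : ∀ x, p x) :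
    FVAll p M := by
  have lift : ∀ {n : ℕ} {p : Fin n → Prop} (m : ℕ), (∀ x, p x) → ∀ x, liftPred p m x := by
    intro n p m h x
    refine Fin.addCases (fun i => ?_) (fun j => ?_) x
    · simpa [liftPred] using h i
    · simp [liftPred]
  induction M with
  | var x => exact hp x
  | glob f => trivial
  | con c M ih => exact fun i => ih i hp
  | app M N ihM ihN => exact ⟨ihM hp, ihN hp⟩
  | lam M ih => exact ih (lift _ hp)
  | fix M ih => exact ih (lift _ hp)
  | mtch M I Q ihM ihQ => exact ⟨ihM hp, fun c => ihQ c (lift _ hp)⟩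

end Term

/-! ### Reduction -/

theorem Value.not_step {P : Program S} {n : ℕ} {V N : Term S n} (hV : Value V) :
    ¬ Step P V N := by
  intro h
  induction h with
  | delta => cases hV
  | beta => cases hV
  | fix => cases hV
  | mtch => cases hV
  | conCtx i _ _ ih =>
    cases hV with
    | con _ _ h => exact ih (h i)
  | appCtxL => cases hV
  | appCtxR => cases hV
  | mtchCtx => cases hV

/-- `Safe` only provides some step to a safe term; determinism identifies it with the step taken by
a given reduction. -/
theorem Step.deterministic {P : Program S} {n : ℕ} {M N N' : Term S n} (h : Step P M N)
    (h' : Step P M N') : N = N' := by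
  induction h generalizing N' with
  | delta h =>
    cases h' with
    | delta h' => rw [h] at h'; cases h'; rfl
  | beta hV =>
    cases h' with
    | beta _ => rfl
    | appCtxL h' => exact ((Value.lam _).not_step h').elim
    | appCtxR h' => exact (hV.not_step h').elim
  | fix => cases h'; rfl
  | @mtch I Q c V hV =>
    -- The types of the branches depend on `I`, so the source is made a variable before the case
    -- split and the equations are recovered by injectivity.
    generalize hT : Term.mtch (Term.con c.1 V) I Q = T at h'
    cases h' with
    | mtch c' hV' =>
      obtain ⟨h1, rfl, h2⟩ := Term.mtch.inj hT
      cases eq_of_heq h2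
      obtain ⟨h3, h4⟩ := Term.con.inj h1
      obtain rfl := Subtype.ext h3
      cases eq_of_heq h4
      rfl
    | mtchCtx h' =>
      obtain ⟨rfl, _, _⟩ := Term.mtch.inj hT
      exact ((Value.con _ _ hV).not_step h').elim
    | _ => cases hT
  | conCtx i hlt h ih =>
    cases h' with
    | conCtx i' hlt' h' =>
      rcases lt_trichotomy i i' with hi | rfl | hi
      · exact ((hlt' i hi).not_step h).elim
      · rw [ih h']
      · exact ((hlt i' hi).not_step h').elim
  | appCtxL h ih =>
    cases h' with
    | beta _ => exact ((Value.lam _).not_step h).elim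
    | appCtxL h' => rw [ih h']
    | appCtxR _ => exact ((Value.lam _).not_step h).elim
  | appCtxR h ih =>
    cases h' with
    | beta hV => exact (hV.not_step h).elim
    | appCtxL h' => exact ((Value.lam _).not_step h').elim
    | appCtxR h' => rw [ih h']
  | @mtchCtx M M' I Q h ih =>
    generalize hT : Term.mtch M I Q = T at h'
    cases h' with
    | mtch c' hV' =>
      obtain ⟨rfl, _, _⟩ := Term.mtch.inj hT
      exact ((Value.con _ _ hV').not_step h).elim
    | mtchCtx h' =>
      obtain ⟨rfl, rfl, h2⟩ := Term.mtch.inj hT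
      cases eq_of_heq h2
      rw [ih h']
    | _ => cases hT

/-- Reduction in exactly `k` steps. -/
def StepsN (P : Program S) {n : ℕ} : ℕ → Term S n → Term S n → Prop
  | 0, M, N => M = N
  | k + 1, M, N => ∃ M', Step P M M' ∧ StepsN P k M' N

theorem Steps.exists_stepsN {P : Program S} {n : ℕ} {M N : Term S n} (h : Steps P M N) :
    ∃ k, StepsN P k M N := by
  induction h using Relation.ReflTransGen.head_induction_on with
  | refl => exact ⟨0, rfl⟩
  | head h _ ih => exact ih.imp' (· + 1) fun k hk => ⟨_, h, hk⟩

theorem StepsN.eq_of_value {P : Program S} {n k : ℕ} {V N : Term S n} (h : StepsN P k V N)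
    (hV : Value V) : V = N := by
  cases k with
  | zero => exact h
  | succ k => obtain ⟨_, h, _⟩ := h; exact (hV.not_step h).elim

/-- The evaluation contexts force the order: function, argument, β-step, body. The exact count shows
each part to be shorter than the whole, as the left rules require. -/
theorem StepsN.app_value {P : Program S} {n k : ℕ} {M N V : Term S n}
    (h : StepsN P k (.app M N) V) (hV : Value V) :
    ∃ Q W a b c, StepsN P a M (.lam Q) ∧ StepsN P b N W ∧ Value W ∧
      StepsN P c (Q.inst fun _ => W) V ∧ k = a + b + c + 1 := by
  induction k generalizing M N with
  | zero => cases h; cases hV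
  | succ k ih =>
    obtain ⟨T, hT, h⟩ := h
    cases hT with
    | beta hN => exact ⟨_, _, 0, 0, k, rfl, rfl, hN, h, by omega⟩
    | appCtxL hM =>
      obtain ⟨Q, W, a, b, c, h1, h2, h3, h4, rfl⟩ := ih h
      exact ⟨Q, W, a + 1, b, c, ⟨_, hM, h1⟩, h2, h3, h4, by omega⟩
    | appCtxR hN =>
      obtain ⟨Q, W, a, b, c, h1, h2, h3, h4, rfl⟩ := ih h
      -- The function part is already an abstraction, so its evaluation has length `a = 0`.
      cases h1.eq_of_value (.lam _)
      exact ⟨_, W, 0, b + 1, c, rfl, ⟨_, hN, h2⟩, h3, h4, by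
        cases a with
        | zero => omega
        | succ a => obtain ⟨_, h, _⟩ := h1; exact ((Value.lam _).not_step h).elim⟩

theorem StepsN.con_value {P : Program S} {n k : ℕ} {c : S.Con} {M : Fin (S.arity c) → Term S n}
    {V : Term S n} (h : StepsN P k (.con c M) V) (hV : Value V) :
    ∃ W, V = .con c W ∧ ∀ i, Value (W i) ∧ ∃ j ≤ k, StepsN P j (M i) (W i) := by
  induction k generalizing M with
  | zero =>
    cases h
    cases hV with
    | con _ _ h => exact ⟨M, rfl, fun i => ⟨h i, 0, le_rfl, rfl⟩⟩
  | succ k ih =>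
    obtain ⟨T, hT, h⟩ := h
    cases hT with
    | conCtx i _ hi =>
      obtain ⟨W, rfl, hW⟩ := ih h
      refine ⟨W, rfl, fun l => ⟨(hW l).1, ?_⟩⟩
      obtain ⟨j, hj, hl⟩ := (hW l).2
      by_cases hli : l = i
      · subst hli
        rw [Function.update_self] at hl
        exact ⟨j + 1, by omega, _, hi, hl⟩
      · rw [Function.update_of_ne hli] at hl
        exact ⟨j, by omega, hl⟩

theorem StepsN.mtch_value {P : Program S} {n k : ℕ} {M : Term S n} {I : Finset S.Con}
    {Q : (c : {c // c ∈ I}) → Term S (n + S.arity c.1)} {V : Term S n}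
    (h : StepsN P k (.mtch M I Q) V) (hV : Value V) :
    ∃ (c : {c // c ∈ I}) (W : Fin (S.arity c.1) → Term S n) (a b : ℕ),
      StepsN P a M (.con c.1 W) ∧ (∀ i, Value (W i)) ∧ StepsN P b ((Q c).inst W) V ∧
        k = a + b + 1 := by
  induction k generalizing M with
  | zero => cases h; cases hV
  | succ k ih =>
    obtain ⟨T, hT, h⟩ := h
    cases hT with
    | mtch c hW => exact ⟨c, _, 0, k, rfl, hW, h, by omega⟩
    | mtchCtx hM =>
      obtain ⟨c, W, a, b, h1, h2, h3, rfl⟩ := ih h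
      exact ⟨c, W, a + 1, b, ⟨_, hM, h1⟩, h2, h3, by omega⟩

theorem Step.pair_left {P : Program S} {n : ℕ} {M M' N : Term S n} (h : Step P M M') :
    Step P (.pair M N) (.pair M' N) := by
  have hp := S.arity_pair
  have hs := Step.conCtx (c := S.pair) (M := fun i => if i.val = 0 then M else N)
    ⟨0, by omega⟩ (fun j hj => by simp [Fin.lt_def] at hj) h
  have he : Function.update (fun i : Fin (S.arity S.pair) => if i.val = 0 then M else N)
      ⟨0, by omega⟩ M' = fun i => if i.val = 0 then M' else N := by
    funext i
    rw [Function.update_apply]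
    by_cases hi : i.val = 0 <;> simp [Fin.ext_iff, hi]
  rw [he] at hs
  exact hs

theorem Step.pair_right {P : Program S} {n : ℕ} {V N N' : Term S n} (hV : Value V)
    (h : Step P N N') : Step P (.pair V N) (.pair V N') := by
  have hp := S.arity_pair
  have hs := Step.conCtx (c := S.pair) (M := fun i => if i.val = 0 then V else N)
    ⟨1, by omega⟩ (fun j hj => by
      have : j.val = 0 := by simpa [Fin.lt_def] using hj
      simpa [this] using hV) h
  have he : Function.update (fun i : Fin (S.arity S.pair) => if i.val = 0 then V else N)
      ⟨1, by omega⟩ N' = fun i => if i.val = 0 then V else N' := by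
    funext i
    rw [Function.update_apply]
    by_cases hi : i.val = 0
    · simp [Fin.ext_iff, hi]
    · have : i.val = 1 := by have := i.isLt; omega
      simp [Fin.ext_iff, this]
  rw [he] at hs
  exact hs

/-- The left match rule has a premise about the pair of scrutinee and branch; this supplies its
evaluation from the two separate ones. -/
theorem StepsN.pair {P : Program S} {n a b : ℕ} {M N V W : Term S n} (hM : StepsN P a M V)
    (hV : Value V) (hN : StepsN P b N W) : StepsN P (a + b) (.pair M N) (.pair V W) := by
  induction a generalizing M with
  | zero =>
    cases hM
    rw [Nat.zero_add]
    induction b generalizing N with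
    | zero => cases hN; rfl
    | succ b ih =>
      obtain ⟨N', h, hN⟩ := hN
      exact ⟨_, .pair_right hV h, ih hN⟩
  | succ a ih =>
    obtain ⟨M', h, hM⟩ := hM
    rw [show a + 1 + b = a + b + 1 by omega]
    exact ⟨_, .pair_left h, ih hM⟩

theorem Value.pair {n : ℕ} {V W : Term S n} (hV : Value V) (hW : Value W) :
    Value (Term.pair V W) :=
  .con _ _ fun i => by by_cases hi : i.val = 0 <;> simpa [hi]

/-! ### Type substitution -/

namespace Ty

theorem subst_subst (σ τ : ℕ → Ty S) (A : Ty S) :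
    (A.subst σ).subst τ = A.subst fun a => (σ a).subst τ := by
  induction A with
  | var a => rfl
  | sum I A ih => simp [subst, ih]
  | ok => rfl
  | arr A B ihA ihB => simp [subst, ihA, ihB]
  | nec A B ihA ihB => simp [subst, ihA, ihB]

theorem subst_congr {σ τ : ℕ → Ty S} {A : Ty S} (h : ∀ a ∈ A.fv, σ a = τ a) :
    A.subst σ = A.subst τ := by
  induction A with
  | var a => exact h a rfl
  | sum I A ih =>
    simp only [subst]
    congr 1
    funext c i
    exact ih c i fun a ha => h a (Set.mem_iUnion₂.2 ⟨c, i, ha⟩)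
  | ok => rfl
  | arr A B ihA ihB =>
    simp only [subst]
    rw [ihA fun a ha => h a (Or.inl ha), ihB fun a ha => h a (Or.inr ha)]
  | nec A B ihA ihB =>
    simp only [subst]
    rw [ihA fun a ha => h a (Or.inl ha), ihB fun a ha => h a (Or.inr ha)]

theorem subst_var (A : Ty S) : A.subst var = A := by
  induction A with
  | var a => rfl
  | sum I A ih => simp [subst, ih]
  | ok => rfl
  | arr A B ihA ihB => simp [subst, ihA, ihB]
  | nec A B ihA ihB => simp [subst, ihA, ihB]

theorem subst_of_fv_eq_empty {A : Ty S} (h : A.fv = ∅) (σ τ : ℕ → Ty S) :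
    A.subst σ = A.subst τ :=
  subst_congr (by simp [h])

end Ty

theorem Sub.subst {C D : Set (Constr S)} {τ : ℕ → Ty S}
    (hC : ∀ A B, (A, B) ∈ C → Sub D (A.subst τ) (B.subst τ)) {A B : Ty S} (h : Sub C A B) :
    Sub D (A.subst τ) (B.subst τ) := by
  induction h with
  | id h => exact hC _ _ h
  | trans _ _ ih ih' => exact ih.trans ih'
  | arr _ _ ih ih' => exact .arr ih ih'
  | nec _ _ ih ih' => exact .nec ih ih'
  | ok => exact .ok
  | sum hIJ _ ih => exact .sum hIJ ih

/-! ### Inversion of subtyping over a consistent constraint set -/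

/-- The reflexive closure of subtyping. -/
def SubEq (C : Set (Constr S)) (A B : Ty S) : Prop := A = B ∨ Sub C A B

theorem SubEq.trans {C : Set (Constr S)} {A B D : Ty S} (h : SubEq C A B) (h' : SubEq C B D) :
    SubEq C A D := by
  rcases h with rfl | h
  · exact h'
  · rcases h' with rfl | h'
    · exact Or.inr h
    · exact Or.inr (h.trans h')

/-- A type that is not a type variable. -/
def Ty.IsProper (A : Ty S) : Prop := ∀ a, A ≠ .var a

/-- Subtyping between proper types that follows their outermost type constructors. -/
inductive StructSub (C : Set (Constr S)) : Ty S → Ty S → Prop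
  | ok (A : Ty S) : StructSub C A .ok
  | arr {A B A' B' : Ty S} : SubEq C A' A → SubEq C B B' → StructSub C (.arr A B) (.arr A' B')
  | nec {A B A' B' : Ty S} : SubEq C A A' → SubEq C B' B → StructSub C (.nec A B) (.nec A' B')
  | sum {I J : Finset S.Con} (hIJ : I ⊆ J)
      {A : (c : {c // c ∈ I}) → Fin (S.arity c.1) → Ty S}
      {B : (c : {c // c ∈ J}) → Fin (S.arity c.1) → Ty S} :
      (∀ (c : {c // c ∈ I}) (i : Fin (S.arity c.1)), SubEq C (A c i) (B ⟨c.1, hIJ c.2⟩ i)) →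
      StructSub C (.sum I A) (.sum J B)

theorem StructSub.refl {C : Set (Constr S)} {A : Ty S} (hA : A.IsProper) : StructSub C A A := by
  cases A with
  | var a => exact (hA a rfl).elim
  | sum I A => exact .sum (Finset.Subset.refl I) fun c i => Or.inl rfl
  | ok => exact .ok _
  | arr A B => exact .arr (Or.inl rfl) (Or.inl rfl)
  | nec A B => exact .nec (Or.inl rfl) (Or.inl rfl)

theorem StructSub.trans {C : Set (Constr S)} {A B D : Ty S} (h : StructSub C A B)
    (h' : StructSub C B D) : StructSub C A D := by
  cases h' with
  | ok => exact .ok _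
  | arr h₁' h₂' =>
    cases h with
    | arr h₁ h₂ => exact .arr (h₁'.trans h₁) (h₂.trans h₂')
  | nec h₁' h₂' =>
    cases h with
    | nec h₁ h₂ => exact .nec (h₁.trans h₁') (h₂'.trans h₂)
  | sum hJK h' =>
    cases h with
    | sum hIJ h => exact .sum (hIJ.trans hJK) fun c i =>
        (h c i).trans (h' ⟨c.1, hIJ c.2⟩ i)

/-- Consistency restricts the outer shapes, and closure of the set provides the constraints between
the components. -/
theorem StructSub.of_mem {C : Set (Constr S)} (hC : ConsistentConstr C) {A B : Ty S}
    (h : (A, B) ∈ C) (hA : A.IsProper) (hB : B.IsProper) : StructSub C A B := by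
  have hs := hC.2 A B h
  cases hs with
  | varL a => exact (hA a rfl).elim
  | varR _ b => exact (hB b rfl).elim
  | arr => exact .arr (Or.inr (.id (hC.1.arr _ _ _ _ h).1)) (Or.inr (.id (hC.1.arr _ _ _ _ h).2))
  | nec => exact .nec (Or.inr (.id (hC.1.nec _ _ _ _ h).1)) (Or.inr (.id (hC.1.nec _ _ _ _ h).2))
  | ok => exact .ok _
  | sum hIJ =>
    exact .sum hIJ fun c i => Or.inr (Sub.id (hC.1.sum _ _ _ _ h c.1 c.2 (hIJ c.2) i))

/-- `A ⊑ B` by a constraint, or by a structural step between proper types that may be preceded and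
followed by a constraint whose other side is a variable. -/
def Factors (C : Set (Constr S)) (A B : Ty S) : Prop :=
  (A, B) ∈ C ∨ ∃ G H : Ty S, G.IsProper ∧ H.IsProper ∧ (A = G ∨ (A, G) ∈ C ∨ G = .ok) ∧
    StructSub C G H ∧ (H = B ∨ (H, B) ∈ C)

theorem Factors.of_structSub {C : Set (Constr S)} {A B : Ty S} (hA : A.IsProper)
    (hB : B.IsProper) (h : StructSub C A B) : Factors C A B :=
  Or.inr ⟨A, B, hA, hB, Or.inl rfl, h, Or.inl rfl⟩

theorem Factors.structSub {C : Set (Constr S)} (hC : ConsistentConstr C) {A B : Ty S}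
    (h : Factors C A B) (hA : A.IsProper) (hB : B.IsProper) : StructSub C A B := by
  rcases h with h | ⟨G, H, hG, hH, hAG, hGH, hHB⟩
  · exact .of_mem hC h hA hB
  · have h1 : StructSub C A G := by
      rcases hAG with rfl | h | rfl
      · exact .refl hA
      · exact .of_mem hC h hA hG
      · exact .ok _
    have h2 : StructSub C H B := by
      rcases hHB with rfl | h
      · exact .refl hB
      · exact .of_mem hC h hH hB
    exact (h1.trans hGH).trans h2

/-- The middle type may be a variable, which carries no structure. It is then entered and left
through constraints, so closure under transitivity composes these into one constraint between the
types on either side of it. The alternative `G = .ok` covers a variable placed below `Ok` by the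
rule instead of by a constraint. -/
theorem Factors.trans {C : Set (Constr S)} (hC : ConsistentConstr C) {A B D : Ty S}
    (h : Factors C A B) (h' : Factors C B D) : Factors C A D := by
  have hok : (Ty.ok : Ty S).IsProper := fun a => by simp
  rcases h with h | ⟨G, H, hG, hH, hAG, hGH, hHB⟩
  · rcases h' with h' | ⟨G', H', hG', hH', hBG', hGH', hHD'⟩
    · exact Or.inl (hC.1.trans _ _ _ h h')
    · refine Or.inr ⟨G', H', hG', hH', ?_, hGH', hHD'⟩
      rcases hBG' with rfl | hBG' | rfl
      · exact Or.inr (Or.inl h)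
      · exact Or.inr (Or.inl (hC.1.trans _ _ _ h hBG'))
      · exact Or.inr (Or.inr rfl)
  · rcases h' with h' | ⟨G', H', hG', hH', hBG', hGH', hHD'⟩
    · refine Or.inr ⟨G, H, hG, hH, hAG, hGH, Or.inr ?_⟩
      rcases hHB with rfl | hHB
      · exact h'
      · exact hC.1.trans _ _ _ hHB h'
    · refine Or.inr ⟨G, H', hG, hH', hAG, hGH.trans (StructSub.trans ?_ hGH'), hHD'⟩
      rcases hBG' with rfl | hBG' | rfl
      · rcases hHB with rfl | hHB
        · exact .refl hH
        · exact .of_mem hC hHB hH hG'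
      · rcases hHB with rfl | hHB
        · exact .of_mem hC hBG' hH hG'
        · exact .of_mem hC (hC.1.trans _ _ _ hHB hBG') hH hG'
      · exact .ok _

theorem Sub.factors {C : Set (Constr S)} (hC : ConsistentConstr C) {A B : Ty S}
    (h : Sub C A B) : Factors C A B := by
  induction h with
  | id h => exact Or.inl h
  | trans _ _ ih ih' => exact ih.trans hC ih'
  | arr h h' =>
    exact .of_structSub (fun a => by simp) (fun a => by simp) (.arr (Or.inr h) (Or.inr h'))
  | nec h h' =>
    exact .of_structSub (fun a => by simp) (fun a => by simp) (.nec (Or.inr h) (Or.inr h'))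
  | ok => exact Or.inr ⟨.ok, .ok, fun a => by simp, fun a => by simp, Or.inr (Or.inr rfl), .ok _,
      Or.inl rfl⟩
  | sum hIJ h =>
    exact .of_structSub (fun a => by simp) (fun a => by simp) (.sum hIJ fun c i => Or.inr (h c i))

theorem SubEq.structSub {C : Set (Constr S)} (hC : ConsistentConstr C) {A B : Ty S}
    (h : SubEq C A B) (hA : A.IsProper) (hB : B.IsProper) : StructSub C A B := by
  rcases h with rfl | h
  · exact .refl hA
  · exact (h.factors hC).structSub hC hA hB

/-! ### Inhabitation of types by closed values -/

/-- The values of each type, given the abstractions `λx. Q` of each arrow type. -/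
inductive Inh (C : Set (Constr S)) (Arr Nec : Term S 1 → Ty S → Ty S → Prop) :
    Term S 0 → Ty S → Prop
  | ok (V : Term S 0) : Inh C Arr Nec V .ok
  | con {c : S.Con} {V : Fin (S.arity c) → Term S 0}
      {A : (d : {d // d ∈ ({c} : Finset S.Con)}) → Fin (S.arity d.1) → Ty S} :
      (∀ i, Inh C Arr Nec (V i) (A ⟨c, Finset.mem_singleton_self c⟩ i)) →
      Inh C Arr Nec (.con c V) (.sum {c} A)
  | arr {Q : Term S 1} {B A : Ty S} : Arr Q B A → Inh C Arr Nec (.lam Q) (.arr B A)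
  | nec {Q : Term S 1} {B A : Ty S} : Nec Q B A → Inh C Arr Nec (.lam Q) (.nec B A)
  | sub {V : Term S 0} {A B : Ty S} : Sub C A B → Inh C Arr Nec V A → Inh C Arr Nec V B

namespace Inh

variable {C : Set (Constr S)} {Arr Nec Arr' Nec' : Term S 1 → Ty S → Ty S → Prop}

theorem mono (hArr : ∀ Q B A, Arr Q B A → Arr' Q B A) (hNec : ∀ Q B A, Nec Q B A → Nec' Q B A)
    {V : Term S 0} {A : Ty S} (h : Inh C Arr Nec V A) : Inh C Arr' Nec' V A := by
  induction h with
  | ok V => exact .ok V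
  | con _ ih => exact .con ih
  | arr h => exact .arr (hArr _ _ _ h)
  | nec h => exact .nec (hNec _ _ _ h)
  | sub h _ ih => exact .sub h ih

theorem subEq {V : Term S 0} {A B : Ty S} (h : Inh C Arr Nec V A) (hs : SubEq C A B) :
    Inh C Arr Nec V B := by
  rcases hs with rfl | hs
  · exact h
  · exact .sub hs h

/-- A membership is obtained by subsumption from one given by the shape of the value. -/
theorem exists_generator {V : Term S 0} {B : Ty S} (h : Inh C Arr Nec V B) :
    ∃ G, SubEq C G B ∧ (G = .ok ∨
      (∃ (c : S.Con) (W : Fin (S.arity c) → Term S 0)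
        (A : (d : {d // d ∈ ({c} : Finset S.Con)}) → Fin (S.arity d.1) → Ty S),
        V = .con c W ∧ G = .sum {c} A ∧
          ∀ i, Inh C Arr Nec (W i) (A ⟨c, Finset.mem_singleton_self c⟩ i)) ∨
      (∃ Q B A, V = .lam Q ∧ G = .arr B A ∧ Arr Q B A) ∨
      (∃ Q B A, V = .lam Q ∧ G = .nec B A ∧ Nec Q B A)) := by
  induction h with
  | ok V => exact ⟨.ok, Or.inl rfl, Or.inl rfl⟩
  | con h _ => exact ⟨_, Or.inl rfl, Or.inr (Or.inl ⟨_, _, _, rfl, rfl, h⟩)⟩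
  | arr h => exact ⟨_, Or.inl rfl, Or.inr (Or.inr (Or.inl ⟨_, _, _, rfl, rfl, h⟩))⟩
  | nec h => exact ⟨_, Or.inl rfl, Or.inr (Or.inr (Or.inr ⟨_, _, _, rfl, rfl, h⟩))⟩
  | sub hs _ ih =>
    obtain ⟨G, hG, h⟩ := ih
    exact ⟨G, hG.trans (Or.inr hs), h⟩

/-- Constructors, other abstractions and plain `Ok` generate types whose outer shape is not below a
sufficiency arrow, which leaves one kind of generator. -/
theorem arr_inv (hC : ConsistentConstr C) {V : Term S 0} {B A : Ty S} (h : Inh C Arr Nec V (.arr B A)) :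
    ∃ Q B' A', V = .lam Q ∧ Arr Q B' A' ∧ SubEq C B B' ∧ SubEq C A' A := by
  obtain ⟨G, hs, h⟩ := h.exists_generator
  rcases h with rfl | ⟨c, W, D, rfl, rfl, _⟩ | ⟨Q, B', A', rfl, rfl, h⟩ | ⟨Q, B', A', rfl, rfl, h⟩
  · cases hs.structSub hC (fun a => by simp) (fun a => by simp)
  · cases hs.structSub hC (fun a => by simp) (fun a => by simp)
  · cases hs.structSub hC (fun a => by simp) (fun a => by simp) with
    | arr h₁ h₂ => exact ⟨Q, B', A', rfl, h, h₁, h₂⟩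
  · cases hs.structSub hC (fun a => by simp) (fun a => by simp)

theorem nec_inv (hC : ConsistentConstr C) {V : Term S 0} {B A : Ty S} (h : Inh C Arr Nec V (.nec B A)) :
    ∃ Q B' A', V = .lam Q ∧ Nec Q B' A' ∧ SubEq C B' B ∧ SubEq C A A' := by
  obtain ⟨G, hs, h⟩ := h.exists_generator
  rcases h with rfl | ⟨c, W, D, rfl, rfl, _⟩ | ⟨Q, B', A', rfl, rfl, h⟩ | ⟨Q, B', A', rfl, rfl, h⟩
  · cases hs.structSub hC (fun a => by simp) (fun a => by simp)
  · cases hs.structSub hC (fun a => by simp) (fun a => by simp)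
  · cases hs.structSub hC (fun a => by simp) (fun a => by simp)
  · cases hs.structSub hC (fun a => by simp) (fun a => by simp) with
    | nec h₁ h₂ => exact ⟨Q, B', A', rfl, h, h₁, h₂⟩

theorem sum_inv (hC : ConsistentConstr C) {V : Term S 0} {I : Finset S.Con}
    {A : (c : {c // c ∈ I}) → Fin (S.arity c.1) → Ty S} (h : Inh C Arr Nec V (.sum I A)) :
    ∃ (c : {c // c ∈ I}) (W : Fin (S.arity c.1) → Term S 0), V = .con c.1 W ∧
      ∀ i, Inh C Arr Nec (W i) (A c i) := by
  obtain ⟨G, hs, h⟩ := h.exists_generator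
  rcases h with rfl | ⟨c, W, D, rfl, rfl, h⟩ | ⟨Q, B', A', rfl, rfl, h⟩ | ⟨Q, B', A', rfl, rfl, h⟩
  · cases hs.structSub hC (fun a => by simp) (fun a => by simp)
  · cases hs.structSub hC (fun a => by simp) (fun a => by simp) with
    | sum hIJ hA =>
      exact ⟨⟨c, hIJ (Finset.mem_singleton_self c)⟩, W, rfl, fun i =>
        (h i).subEq (hA ⟨c, Finset.mem_singleton_self c⟩ i)⟩
  · cases hs.structSub hC (fun a => by simp) (fun a => by simp)
  · cases hs.structSub hC (fun a => by simp) (fun a => by simp)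

end Inh

/-! ### Types as predicates on closed terms

A typing on the left-hand side of a judgement is read as `Refl`, which does not depend on the
interpretation of arrows.  A typing on the right-hand side is read as `Safe`, which is indexed by a
bound on the number of reduction steps. -/

/-- The types that the outermost shape of a value forces. -/
def Refl (C : Set (Constr S)) : Term S 0 → Ty S → Prop :=
  Inh C (fun _ _ _ => False) (fun _ B _ => B = .ok)

/-- `λx. Q` maps only values of `B` to values of `A`, as observed in fewer than `k` steps. -/
def NecBody (P : Program S) (C : Set (Constr S)) (k : ℕ) (Q : Term S 1) (B A : Ty S) : Prop :=
  ∀ (W V : Term S 0) (j : ℕ), j < k → Value W → Value V →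
    StepsN P j (Q.inst (n := 0) (m := 1) fun _ => W) V → Refl C V A → Refl C W B

/-- The abstractions of each sufficiency arrow type, and the terms that are safe at each type, as
observed in fewer than `k` steps. -/
def arrSafe (P : Program S) (C : Set (Constr S)) :
    ℕ → (Term S 1 → Ty S → Ty S → Prop) × (Term S 0 → Ty S → Prop)
  | 0 => (fun _ _ _ => True, fun _ _ => True)
  | k + 1 =>
    let arr : Term S 1 → Ty S → Ty S → Prop := fun Q B A => (arrSafe P C k).1 Q B A ∧
      ∀ W, Value W → Inh C (arrSafe P C k).1 (NecBody P C k) W B →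
        (arrSafe P C k).2 (Q.inst (n := 0) (m := 1) fun _ => W) A
    (arr, fun M A => (Value M ∧ Inh C arr (NecBody P C (k + 1)) M A) ∨
      ∃ N, Step P M N ∧ (arrSafe P C k).2 N A)

/-- `λx. Q` maps values of `B` to safe terms of `A`, as observed in fewer than `k` steps. -/
def ArrBody (P : Program S) (C : Set (Constr S)) (k : ℕ) : Term S 1 → Ty S → Ty S → Prop :=
  (arrSafe P C k).1

/-- The values of each type, as observed in fewer than `k` steps. -/
def Val (P : Program S) (C : Set (Constr S)) (k : ℕ) : Term S 0 → Ty S → Prop :=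
  Inh C (ArrBody P C k) (NecBody P C k)

/-- `M` is not stuck within fewer than `k` steps, and any value reached has type `A`. -/
def Safe (P : Program S) (C : Set (Constr S)) (k : ℕ) : Term S 0 → Ty S → Prop :=
  (arrSafe P C k).2

section

/-! ### Monotonicity in the step bound, and safety of compound terms -/

variable {P : Program S} {C : Set (Constr S)}

theorem arrBody_succ {k : ℕ} {Q : Term S 1} {B A : Ty S} :
    ArrBody P C (k + 1) Q B A ↔ ArrBody P C k Q B A ∧
      ∀ W, Value W → Val P C k W B →
        Safe P C k (Q.inst (n := 0) (m := 1) fun _ => W) A := Iff.rfl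

theorem safe_zero (M : Term S 0) (A : Ty S) : Safe P C 0 M A := trivial

theorem safe_succ {k : ℕ} {M : Term S 0} {A : Ty S} :
    Safe P C (k + 1) M A ↔ (Value M ∧ Val P C (k + 1) M A) ∨
      ∃ N, Step P M N ∧ Safe P C k N A := Iff.rfl

theorem NecBody.anti {k l : ℕ} (hlk : l ≤ k) {Q : Term S 1} {B A : Ty S}
    (h : NecBody P C k Q B A) : NecBody P C l Q B A :=
  fun W V j hj => h W V j (hj.trans_le hlk)

theorem ArrBody.anti {k l : ℕ} (hlk : l ≤ k) {Q : Term S 1} {B A : Ty S}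
    (h : ArrBody P C k Q B A) : ArrBody P C l Q B A := by
  induction hlk with
  | refl => exact h
  | step _ ih => exact ih (arrBody_succ.1 h).1

theorem ArrBody.safe_inst {k l : ℕ} (hlk : l < k) {Q : Term S 1} {B A : Ty S}
    (h : ArrBody P C k Q B A) {W : Term S 0} (hW : Value W) (hWB : Val P C l W B) :
    Safe P C l (Q.inst (n := 0) (m := 1) fun _ => W) A :=
  (arrBody_succ.1 (h.anti hlk)).2 W hW hWB

theorem arrBody_of_forall {k : ℕ} {Q : Term S 1} {B A : Ty S}
    (h : ∀ l < k, ∀ W, Value W → Val P C l W B →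
      Safe P C l (Q.inst (n := 0) (m := 1) fun _ => W) A) : ArrBody P C k Q B A := by
  induction k with
  | zero => trivial
  | succ k ih => exact arrBody_succ.2 ⟨ih fun l hl => h l (by omega), h k (by omega)⟩

theorem Val.anti {k l : ℕ} (hlk : l ≤ k) {V : Term S 0} {A : Ty S} (h : Val P C k V A) :
    Val P C l V A :=
  Inh.mono (fun _ _ _ => ArrBody.anti hlk) (fun _ _ _ => NecBody.anti hlk) h

theorem Safe.anti {k l : ℕ} (hlk : l ≤ k) {M : Term S 0} {A : Ty S} (h : Safe P C k M A) :
    Safe P C l M A := by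
  induction k generalizing l M with
  | zero => obtain rfl := Nat.le_zero.1 hlk; exact h
  | succ k ih =>
    cases l with
    | zero => exact safe_zero _ _
    | succ l =>
      rcases safe_succ.1 h with ⟨hM, hA⟩ | ⟨N, hN, hA⟩
      · exact safe_succ.2 (Or.inl ⟨hM, hA.anti hlk⟩)
      · exact safe_succ.2 (Or.inr ⟨N, hN, ih (by omega) hA⟩)

theorem Safe.subEq {k : ℕ} {M : Term S 0} {A B : Ty S} (h : Safe P C k M A)
    (hs : SubEq C A B) : Safe P C k M B := by
  induction k generalizing M with
  | zero => exact safe_zero _ _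
  | succ k ih =>
    rcases safe_succ.1 h with ⟨hM, hA⟩ | ⟨N, hN, hA⟩
    · exact safe_succ.2 (Or.inl ⟨hM, Inh.subEq hA hs⟩)
    · exact safe_succ.2 (Or.inr ⟨N, hN, ih hA⟩)

theorem Safe.of_val {k : ℕ} {V : Term S 0} {A : Ty S} (hV : Value V) (h : Val P C k V A) :
    Safe P C k V A := by
  cases k with
  | zero => exact safe_zero _ _
  | succ k => exact safe_succ.2 (Or.inl ⟨hV, h⟩)

theorem Safe.of_step {k : ℕ} {M N : Term S 0} {A : Ty S} (hM : Step P M N)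
    (h : Safe P C (k - 1) N A) : Safe P C k M A := by
  cases k with
  | zero => exact safe_zero _ _
  | succ k => exact safe_succ.2 (Or.inr ⟨N, hM, h⟩)

theorem Safe.stepsN {k j : ℕ} {M N : Term S 0} {A : Ty S} (h : Safe P C (k + j) M A)
    (hM : StepsN P j M N) : Safe P C k N A := by
  induction j generalizing M with
  | zero => cases hM; exact h
  | succ j ih =>
    obtain ⟨M', h', hM⟩ := hM
    rcases safe_succ.1 h with ⟨hV, _⟩ | ⟨N', hN, hA⟩
    · exact (hV.not_step h').elim
    · obtain rfl := h'.deterministic hN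
      exact ih hA hM

theorem Safe.val {k : ℕ} {V : Term S 0} {A : Ty S} (hV : Value V) (h : Safe P C (k + 1) V A) :
    Val P C (k + 1) V A := by
  rcases safe_succ.1 h with ⟨_, hA⟩ | ⟨N, hN, _⟩
  · exact hA
  · exact (hV.not_step hN).elim

theorem not_goesWrong_of_safe {M : Term S 0} {A : Ty S} (h : ∀ k, Safe P C k M A) :
    ¬ GoesWrong P M := by
  rintro ⟨N, hN, hstep, hval⟩
  obtain ⟨j, hj⟩ := hN.exists_stepsN
  -- Safety at level `j + 1` leaves level 1 after `j` steps, enough to rule out a stuck term.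
  rcases safe_succ.1 ((h (0 + 1 + j)).stepsN hj) with ⟨hV, _⟩ | ⟨N', h', _⟩
  · exact hval hV
  · exact hstep ⟨N', h'⟩

/-- `Refl` generates no sufficiency arrows, and its necessity arrows have argument type `Ok`, so
what they claim of the argument always holds. -/
theorem Refl.val {V : Term S 0} {A : Ty S} (h : Refl C V A) (k : ℕ) : Val P C k V A :=
  Inh.mono (fun _ _ _ h => h.elim)
    (fun _ _ _ h _ _ _ _ _ _ _ _ => h ▸ Inh.ok _) h

theorem Safe.of_refl {M V : Term S 0} {A : Ty S} {j : ℕ} (hM : StepsN P j M V) (hV : Value V)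
    (h : Refl C V A) (k : ℕ) : Safe P C k M A := by
  induction j generalizing M k with
  | zero => cases hM; exact .of_val hV (h.val k)
  | succ j ih =>
    obtain ⟨M', h', hM⟩ := hM
    exact .of_step h' (ih hM _)

/-- Safety of an evaluation context, from safety of its hole. -/
theorem Safe.bind {F : Term S 0 → Term S 0} {k : ℕ} {M : Term S 0} {A B : Ty S}
    (hF : ∀ {M N}, Step P M N → Step P (F M) (F N)) (h : Safe P C k M A)
    (hV : ∀ l ≤ k, ∀ V, Value V → Val P C l V A → Safe P C l (F V) B) :
    Safe P C k (F M) B := by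
  induction k generalizing M with
  | zero => exact safe_zero _ _
  | succ k ih =>
    rcases safe_succ.1 h with ⟨hM, hA⟩ | ⟨N, hN, hA⟩
    · exact hV _ le_rfl _ hM hA
    · exact .of_step (hF hN) (ih hA fun l hl => hV l (by omega))

theorem Safe.app (hC : ConsistentConstr C) {k : ℕ} {M N : Term S 0} {A B : Ty S}
    (hM : Safe P C k M (.arr B A)) (hN : Safe P C k N B) : Safe P C k (.app M N) A := by
  refine hM.bind (F := fun M => .app M N) Step.appCtxL fun l hl V _ hV => ?_
  obtain ⟨Q, B', A', rfl, hQ, hB, hA⟩ := Inh.arr_inv hC hV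
  refine (hN.anti hl).bind (F := fun N => .app (.lam Q) N) Step.appCtxR fun j hj W hW hWB => ?_
  cases j with
  | zero => exact safe_zero _ _
  | succ j =>
    -- The β-step pays for the drop from `j + 1` to `j`, strictly below the level at which the
    -- abstraction is typed.
    exact .of_step (.beta hW) ((hQ.safe_inst (l := j) (by omega) hW
      (Inh.subEq (hWB.anti (by omega)) hB)).subEq hA)

theorem Safe.con {k : ℕ} {c : S.Con} {M : Fin (S.arity c) → Term S 0}
    {A : (d : {d // d ∈ ({c} : Finset S.Con)}) → Fin (S.arity d.1) → Ty S}
    (h : ∀ i, Safe P C k (M i) (A ⟨c, Finset.mem_singleton_self c⟩ i)) :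
    Safe P C k (.con c M) (.sum {c} A) := by
  induction k generalizing M with
  | zero => exact safe_zero _ _
  | succ k ih =>
    by_cases hM : ∀ i, Value (M i)
    · exact .of_val (.con _ _ hM) (Inh.con fun i => (h i).val (hM i))
    · push Not at hM
      -- The leftmost component that is not a value is the one that the evaluation context lets
      -- reduce.
      obtain ⟨i, hi, hmin⟩ := exists_minimal_of_wellFoundedLT (fun i => ¬ Value (M i)) hM
      have hlt : ∀ j, j < i → Value (M j) := fun j hj => by
        by_contra hn
        exact absurd (hmin hn hj.le) (not_le.2 hj)
      rcases safe_succ.1 (h i) with ⟨hV, _⟩ | ⟨N, hN, hA⟩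
      · exact (hi hV).elim
      · refine .of_step (.conCtx i hlt hN) (ih fun j => ?_)
        by_cases hj : j = i
        · subst hj
          simpa using hA
        · rw [Function.update_of_ne hj]
          exact (h j).anti (by simp)

theorem Safe.mtch (hC : ConsistentConstr C) {k : ℕ} {M : Term S 0} {I : Finset S.Con}
    {Q : (c : {c // c ∈ I}) → Term S (0 + S.arity c.1)} {A : Ty S}
    {B : (c : {c // c ∈ I}) → Fin (S.arity c.1) → Ty S} (hM : Safe P C k M (.sum I B))
    (hQ : ∀ l < k, ∀ c V, (∀ i, Value (V i)) → (∀ i, Val P C l (V i) (B c i)) →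
      Safe P C l ((Q c).inst V) A) : Safe P C k (.mtch M I Q) A := by
  refine hM.bind (F := fun M => .mtch M I Q) Step.mtchCtx fun l hl V hv hV => ?_
  obtain ⟨c, W, rfl, hW⟩ := Inh.sum_inv hC hV
  have hv' : ∀ i, Value (W i) := by
    cases hv with
    | con _ _ h => exact h
  cases l with
  | zero => exact safe_zero _ _
  | succ l =>
    exact .of_step (.mtch c hv') (hQ l (by omega) c W hv' fun i => Val.anti (by omega) (hW i))

end

/-! ### Interpretation of judgements -/

/-- An interpretation of `n` local variables.  The variable `x` stands for the closed term
`term x`, whose typings are known for fewer than `bound x` steps; `nec x` holds if `x` is bound by a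
rule that concludes a typing of `x`. -/
structure Valuation (S : Signature) (n : ℕ) where
  term : Fin n → Term S 0
  bound : Fin n → ℕ
  nec : Fin n → Prop

/-- Extend a valuation to `m` further variables. -/
def Valuation.ext {n m : ℕ} (v : Valuation S n) (V : Fin m → Term S 0) (b : ℕ) (p : Prop) :
    Valuation S (n + m) where
  term := Term.ext v.term V
  bound := Fin.addCases v.bound fun _ => b
  nec := Fin.addCases v.nec fun _ => p

namespace Valuation

variable {n m : ℕ} (v : Valuation S n) (V : Fin m → Term S 0) (b : ℕ) (p : Prop)

@[simp] theorem ext_term : (v.ext V b p).term = Term.ext v.term V := rfl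

@[simp] theorem ext_bound_castAdd (i : Fin n) :
    (v.ext V b p).bound (Fin.castAdd m i) = v.bound i := by simp [ext]

@[simp] theorem ext_bound_natAdd (j : Fin m) :
    (v.ext V b p).bound (Fin.natAdd n j) = b := by simp [ext]

@[simp] theorem ext_nec_castAdd (i : Fin n) :
    (v.ext V b p).nec (Fin.castAdd m i) = v.nec i := by simp [ext]

@[simp] theorem ext_nec_natAdd (j : Fin m) :
    (v.ext V b p).nec (Fin.natAdd n j) = p := by simp [ext]

end Valuation

/-- The bounds of the free variables of `M` are all at least `k`. -/
def Below {n : ℕ} (v : Valuation S n) (k : ℕ) (M : Term S n) : Prop :=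
  M.FVAll fun x => k ≤ v.bound x

theorem Below.wk {n m k : ℕ} {v : Valuation S n} {M : Term S n} (h : Below v k M)
    (V : Fin m → Term S 0) (b : ℕ) (p : Prop) : Below (v.ext V b p) k (M.wk m) :=
  Term.FVAll.ren h fun x hx => by simpa using hx

theorem Below.of_liftPred {n m k : ℕ} {v : Valuation S n} {M : Term S (n + m)}
    (h : M.FVAll (Term.liftPred (fun x => k ≤ v.bound x) m)) {l b : ℕ} (hl : l ≤ k) (hb : l ≤ b)
    (V : Fin m → Term S 0) (p : Prop) : Below (v.ext V b p) l M :=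
  Term.FVAll.mono h (Term.liftPred_imp (fun i hi => by simpa using hl.trans hi)
    fun j => by simpa using hb)

theorem Below.anti {n k l : ℕ} {v : Valuation S n} {M : Term S n} (h : Below v k M)
    (hl : l ≤ k) : Below v l M :=
  Term.FVAll.mono h fun _ hx => hl.trans hx

section

variable (P : Program S) (C : Set (Constr S)) (K : ℕ) (τ : ℕ → Ty S)

/-- `N` evaluates to a value of `A`, in fewer steps than the bounds of its free variables. -/
def EvalsTo {n : ℕ} (v : Valuation S n) (N : Term S n) (A : Ty S) : Prop :=
  ∃ (j : ℕ) (V : Term S 0), j < K ∧ Below v (j + 1) N ∧ StepsN P j (N.subst v.term) V ∧ Value V ∧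
    Refl C V (A.subst τ)

/-- Truth of a formula on the left-hand side. -/
def Sat {n : ℕ} (v : Valuation S n) : Formula S n → Prop
  | .typing N A => EvalsTo P C K τ v N A ∨
      (∃ x, N = .var x ∧ ¬ v.nec x ∧ Safe P C (v.bound x) (v.term x) (A.subst τ)) ∨
      (∃ f, N = .glob f ∧ Safe P C K (.glob f) (A.subst τ))
  | .ident f T => ∀ σ : ℕ → Ty S,
      (∀ p ∈ T.constrs, Sub C (p.1.subst σ) (p.2.subst σ)) → Safe P C K (.glob f) (T.body.subst σ)
  | .sub A B => Sub C (A.subst τ) (B.subst τ)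

/-- A valuation that makes the left-hand side true. -/
structure Models {n : ℕ} (v : Valuation S n) (Γ : Env S n) : Prop where
  value : ∀ x, v.nec x → Value (v.term x)
  safe : ∀ x, Safe P C (v.bound x) (v.term x) .ok
  sat : ∀ φ ∈ Γ, Sat P C K τ v φ

/-- Truth of the right-hand side. -/
def SatConcl {n : ℕ} (v : Valuation S n) : Concl S n → Prop
  | none => False
  | some (M, A) =>
      (∀ k ≤ K, Below v k M → Safe P C k (M.subst v.term) (A.subst τ)) ∧
      ∀ x, M = .var x → v.nec x → Refl C (v.term x) (A.subst τ)

variable {P C K τ}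

/-! ### Weakening and structural properties of truth -/

theorem Sat.evalsTo {n : ℕ} {v : Valuation S n} {N : Term S n} {A : Ty S}
    (h : Sat P C K τ v (.typing N A)) (hv : ∀ x, N ≠ .var x) (hg : ∀ f, N ≠ .glob f) :
    EvalsTo P C K τ v N A := by
  rcases h with h | ⟨x, hx, _⟩ | ⟨f, hf, _⟩
  · exact h
  · exact (hv x hx).elim
  · exact (hg f hf).elim

theorem EvalsTo.wk {n m : ℕ} {v : Valuation S n} {N : Term S n} {A : Ty S}
    (h : EvalsTo P C K τ v N A) (V : Fin m → Term S 0) (b : ℕ) (p : Prop) :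
    EvalsTo P C K τ (v.ext V b p) (N.wk m) A := by
  obtain ⟨j, U, hj, hb, hs, hU, hA⟩ := h
  exact ⟨j, U, hj, hb.wk V b p, by rwa [Valuation.ext_term, Term.wk_subst_ext], hU, hA⟩

theorem Sat.wk {n m : ℕ} {v : Valuation S n} {φ : Formula S n} (h : Sat P C K τ v φ)
    (V : Fin m → Term S 0) (b : ℕ) (p : Prop) : Sat P C K τ (v.ext V b p) (φ.wk m) := by
  cases φ with
  | typing N A =>
    rcases h with h | ⟨x, rfl, hx, hs⟩ | ⟨f, rfl, hs⟩
    · exact Or.inl (h.wk V b p)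
    · exact Or.inr (Or.inl ⟨Fin.castAdd m x, rfl, by simpa using hx, by simpa using hs⟩)
    · exact Or.inr (Or.inr ⟨f, rfl, hs⟩)
  | ident f T => exact h
  | sub A B => exact h

theorem Models.mono {n : ℕ} {v : Valuation S n} {Γ Γ' : Env S n} (h : Models P C K τ v Γ)
    (hΓ : Γ' ⊆ Γ) : Models P C K τ v Γ' :=
  ⟨h.value, h.safe, fun φ hφ => h.sat φ (hΓ hφ)⟩

theorem Models.tail {n : ℕ} {v : Valuation S n} {Γ : Env S n} {φ : Formula S n}
    (h : Models P C K τ v (insert φ Γ)) : Models P C K τ v Γ :=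
  h.mono (Set.subset_insert φ Γ)

theorem Models.head {n : ℕ} {v : Valuation S n} {Γ : Env S n} {φ : Formula S n}
    (h : Models P C K τ v (insert φ Γ)) : Sat P C K τ v φ :=
  h.sat φ (Set.mem_insert φ Γ)

theorem Models.insert {n : ℕ} {v : Valuation S n} {Γ : Env S n} {φ : Formula S n}
    (h : Models P C K τ v Γ) (hφ : Sat P C K τ v φ) : Models P C K τ v (insert φ Γ) :=
  ⟨h.value, h.safe, fun ψ hψ => (Set.mem_insert_iff.1 hψ).elim (fun e => e ▸ hφ) (h.sat ψ)⟩

theorem Models.wk {n m : ℕ} {v : Valuation S n} {Γ : Env S n} (h : Models P C K τ v Γ)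
    {V : Fin m → Term S 0} {b : ℕ} {p : Prop} (hp : p → ∀ i, Value (V i))
    (hV : ∀ i, Safe P C b (V i) .ok) : Models P C K τ (v.ext V b p) (Γ.wk m) where
  value x := by
    refine Fin.addCases (fun i => ?_) (fun j => ?_) x
    · simpa using h.value i
    · simpa using fun hp' => hp hp' j
  safe x := by
    refine Fin.addCases (fun i => ?_) (fun j => ?_) x
    · simpa using h.safe i
    · simpa using hV j
  sat := by
    rintro _ ⟨φ, hφ, rfl⟩
    exact (h.sat φ hφ).wk V b p

theorem Models.sub {n : ℕ} {v : Valuation S n} {Γ : Env S n} (h : Models P C K τ v Γ)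
    {A B : Ty S} (hs : Sub Γ.constrs A B) : Sub C (A.subst τ) (B.subst τ) :=
  hs.subst fun A B hAB => h.sat (.sub A B) hAB

theorem Sat.sub {n : ℕ} {v : Valuation S n} {N : Term S n} {A B : Ty S}
    (h : Sat P C K τ v (.typing N A)) (hs : Sub C (A.subst τ) (B.subst τ)) :
    Sat P C K τ v (.typing N B) := by
  rcases h with ⟨j, V, hj, hb, hN, hV, hA⟩ | ⟨x, rfl, hx, hA⟩ | ⟨f, rfl, hA⟩
  · exact Or.inl ⟨j, V, hj, hb, hN, hV, .sub hs hA⟩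
  · exact Or.inr (Or.inl ⟨x, rfl, hx, hA.subEq (Or.inr hs)⟩)
  · exact Or.inr (Or.inr ⟨f, rfl, hA.subEq (Or.inr hs)⟩)

/-- The fresh variables do not occur in the right-hand side, so their bounds do not restrict it. -/
theorem SatConcl.of_wk {n m : ℕ} {v : Valuation S n} {Δ : Concl S n} {V : Fin m → Term S 0}
    {b : ℕ} {p : Prop} (h : SatConcl P C K τ (v.ext V b p) (Δ.wk m)) : SatConcl P C K τ v Δ := by
  cases Δ with
  | none => exact h
  | some q =>
    obtain ⟨M, A⟩ := q
    obtain ⟨h1, h2⟩ := h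
    refine ⟨fun k hk hM => ?_, ?_⟩
    · have := h1 k hk (hM.wk V b p)
      rwa [Valuation.ext_term, Term.wk_subst_ext] at this
    · rintro x rfl hx
      simpa using h2 (Fin.castAdd m x) rfl (by simpa using hx)

/-- An evaluation assumption gives safety at every level, and for a necessity variable the value
reached is its own term, so `Refl` transfers. A step-bounded assumption is admitted only for the
other variables, where safety up to the bound suffices. -/
theorem satConcl_var {n : ℕ} {v : Valuation S n} {x : Fin n} {A : Ty S}
    (hx : v.nec x → Value (v.term x)) (h : Sat P C K τ v (.typing (.var x) A)) :
    SatConcl P C K τ v (some (.var x, A)) := by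
  rcases h with ⟨j, V, hj, hb, hN, hV, hA⟩ | ⟨y, hy, hn, hA⟩ | ⟨f, hf, _⟩
  · refine ⟨fun k _ _ => .of_refl hN hV hA k, ?_⟩
    rintro y hy hn
    cases hy
    obtain rfl := hN.eq_of_value (hx hn)
    exact hA
  · cases hy
    refine ⟨fun k _ hk => hA.anti hk, ?_⟩
    rintro y hy hn'
    cases hy
    exact (hn hn').elim
  · cases hf

theorem SatConcl.not_var {n : ℕ} {v : Valuation S n} {M : Term S n} {A : Ty S}
    (hM : ∀ x, M ≠ .var x)
    (h : ∀ k ≤ K, Below v k M → Safe P C k (M.subst v.term) (A.subst τ)) :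
    SatConcl P C K τ v (some (M, A)) :=
  ⟨h, fun x hx => (hM x hx).elim⟩

/-! ### Soundness of the typing rules -/

theorem satConcl_lam_arr {n : ℕ} {v : Valuation S n} {Γ : Env S n} {M : Term S (n + 1)}
    {A B : Ty S} (hv : Models P C K τ v Γ)
    (ih : ∀ v : Valuation S (n + 1),
      Models P C K τ v (insert (.typing (.var (Fin.natAdd n 0)) B) (Γ.wk 1)) →
      SatConcl P C K τ v (some (M, A))) :
    SatConcl P C K τ v (some (.lam M, .arr B A)) := by
  refine .not_var (fun x => by simp) fun k hk hb => ?_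
  refine .of_val (.lam _) (.arr (arrBody_of_forall fun l hl W hW hWB => ?_))
  have hs := Safe.of_val hW hWB
  -- The argument is known only to level `l`, so `l` bounds the new variable. Lowering `K` instead
  -- could falsify evaluation assumptions in `Γ`.
  have hm := (hv.wk (V := fun _ : Fin 1 => W) (b := l) (p := False) (fun h => h.elim)
    fun _ => hs.subEq (Or.inr .ok)).insert (φ := .typing (.var (Fin.natAdd n 0)) B)
    (Or.inr (Or.inl ⟨_, rfl, by simp, by simpa using hs⟩))
  have := (ih _ hm).1 l (by omega) (Below.of_liftPred hb hl.le le_rfl _ _)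
  rwa [Valuation.ext_term, ← Term.inst_subst_liftSubst] at this

theorem satConcl_lam_nec {n : ℕ} {v : Valuation S n} {Γ : Env S n} {M : Term S (n + 1)}
    {A B : Ty S} (hv : Models P C K τ v Γ)
    (ih : ∀ v : Valuation S (n + 1), Models P C K τ v (insert (.typing M A) (Γ.wk 1)) →
      SatConcl P C K τ v (some (.var (Fin.natAdd n 0), B))) :
    SatConcl P C K τ v (some (.lam M, .nec B A)) := by
  refine .not_var (fun x => by simp) fun k hk hb => ?_
  refine .of_val (.lam _) (.nec fun W V j hj hW hV hWV hA => ?_)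
  -- A value is safe at `Ok` at every level, so the new variable gets the full bound; marking it
  -- `nec` makes the conclusion yield `Refl`.
  have hm := (hv.wk (V := fun _ : Fin 1 => W) (b := K) (p := True) (fun _ _ => hW)
    fun _ => .of_val hW (.ok _)).insert (φ := .typing M A)
    (Or.inl ⟨j, V, by omega, Below.of_liftPred hb hj (by omega) _ _, by
      rwa [Valuation.ext_term, ← Term.inst_subst_liftSubst], hV, hA⟩)
  simpa using (ih _ hm).2 _ rfl (by simp)

/-- An evaluating application has an evaluating argument, and safety of the function at the
necessity arrow turns the type of the result into one of the argument. -/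
theorem evalsTo_app_arg (hC : ConsistentConstr C) {n : ℕ} {v : Valuation S n} {M N : Term S n}
    {A B : Ty S} (hM : SatConcl P C K τ v (some (M, .nec B A)))
    (h : EvalsTo P C K τ v (.app M N) A) : EvalsTo P C K τ v N B := by
  obtain ⟨j, V, hj, hb, hs, hV, hA⟩ := h
  obtain ⟨Q, W, a, b, c, h1, h2, hW, h3, rfl⟩ := hs.app_value hV
  refine ⟨b, W, by omega, Below.anti hb.2 (by omega), h2, hW, ?_⟩
  -- The whole takes `a + b + c + 1` steps and safety is available one level above. After the `a`
  -- steps to the abstraction, level `b + c + 2` remains, which exceeds the length `c` of the body's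
  -- evaluation.
  have hQ := Safe.stepsN (k := b + c + 1 + 1) (j := a)
    ((hM.1 _ (Nat.succ_le_of_lt hj) hb.1).anti (by omega)) h1
  obtain ⟨Q', B', A', hQQ, hN, hBs, hAs⟩ := Inh.nec_inv hC (hQ.val (.lam _))
  cases hQQ
  exact (hN W V c (by omega) hW hV h3 (hA.subEq hAs)).subEq hBs

theorem satConcl_mtch (hC : ConsistentConstr C) {n : ℕ} {v : Valuation S n} {Γ : Env S n}
    {M : Term S n} {I : Finset S.Con} {Q : (c : {c // c ∈ I}) → Term S (n + S.arity c.1)}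
    {A : Ty S} {B : (c : {c // c ∈ I}) → Fin (S.arity c.1) → Ty S} (hv : Models P C K τ v Γ)
    (hM : SatConcl P C K τ v (some (M, .sum I B)))
    (ih : ∀ (c : {c // c ∈ I}) (v : Valuation S (n + S.arity c.1)),
      Models P C K τ v (Γ.wk (S.arity c.1) ∪
        Set.range (fun i => Formula.typing (.var (Fin.natAdd n i)) (B c i))) →
      SatConcl P C K τ v (some (Q c, A))) :
    SatConcl P C K τ v (some (.mtch M I Q, A)) := by
  refine .not_var (fun x => by simp) fun k hk hb => ?_
  refine Safe.mtch hC (hM.1 k hk hb.1) fun l hl c V hV hVB => ?_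
  have hs := fun i => Safe.of_val (hV i) (hVB i)
  have hm := hv.wk (V := V) (b := l) (p := False) (fun h => h.elim)
    fun i => (hs i).subEq (Or.inr .ok)
  have hm' : Models P C K τ (v.ext V l False) (Γ.wk (S.arity c.1) ∪
      Set.range (fun i => Formula.typing (.var (Fin.natAdd n i)) (B c i))) := by
    refine ⟨hm.value, hm.safe, ?_⟩
    rintro φ (hφ | ⟨i, rfl⟩)
    · exact hm.sat φ hφ
    · exact Or.inr (Or.inl ⟨_, rfl, by simp, by simpa using hs i⟩)
  have := (ih c _ hm').1 l (by omega) (Below.of_liftPred (hb.2 c) hl.le le_rfl _ _)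
  rwa [Valuation.ext_term, ← Term.inst_subst_liftSubst] at this

theorem satConcl_of_evalsTo_mtch {n : ℕ} {v : Valuation S n} {Γ : Env S n} {Δ : Concl S n}
    {M : Term S n} {I : Finset S.Con} {Q : (c : {c // c ∈ I}) → Term S (n + S.arity c.1)}
    {A : Ty S} {B : (c : {c // c ∈ I}) → Fin (S.arity c.1) → Ty S} (hv : Models P C K τ v Γ)
    (h : EvalsTo P C K τ v (.mtch M I Q) A)
    (ih : ∀ (c : {c // c ∈ I}) (i : Fin (S.arity c.1)) (v : Valuation S (n + S.arity c.1)),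
      Models P C K τ v (insert (.typing (Q c) A) (Γ.wk (S.arity c.1))) →
      SatConcl P C K τ v (some (.var (Fin.natAdd n i), B c i)))
    (ih' : ∀ (c : {c // c ∈ I}) (v : Valuation S (n + S.arity c.1)),
      Models P C K τ v (insert (.typing (.pair (M.wk (S.arity c.1)) (Q c))
        (.pair (.single B c) A)) (Γ.wk (S.arity c.1))) →
      SatConcl P C K τ v (Δ.wk (S.arity c.1))) :
    SatConcl P C K τ v Δ := by
  obtain ⟨j, U, hj, hb, hs, hU, hA⟩ := h
  obtain ⟨c, W, a, b, h1, hW, h2, rfl⟩ := hs.mtch_value hU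
  rw [Term.inst_subst_liftSubst] at h2
  have hm := hv.wk (V := W) (b := K) (p := True) (fun _ => hW) fun i => .of_val (hW i) (.ok _)
  have hQ : ∀ l ≤ a + b + 1, Below (v.ext W K True) (l + 1) (Q c) := fun l hl =>
    Below.of_liftPred (hb.2 c) (by omega) (by omega) _ _
  -- The branch evaluates at `A`, so the first group of premises types the components that were
  -- matched.
  have hB : ∀ i, Refl C (W i) ((B c i).subst τ) := fun i => by
    simpa using (ih c i _ (hm.insert
      (Or.inl ⟨b, U, by omega, hQ b (by omega), h2, hU, hA⟩))).2 _ rfl (by simp)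
  have hcW : Value (Term.con c.1 W) := .con _ _ hW
  -- Evaluating the pair repeats all steps of the match except the matching step itself, so `a + b`
  -- fits under the same bounds.
  refine (ih' c _ (hm.insert (Or.inl ⟨a + b, .pair (.con c.1 W) U, by omega, fun i => ?_, ?_,
    hcW.pair hU, ?_⟩))).of_wk
  · change Below _ _ (if i.val = 0 then _ else _)
    by_cases hi : i.val = 0
    · simpa only [hi, if_true] using (Below.anti hb.1 (l := a + b + 1) (by omega)).wk W K True
    · simpa only [hi, if_false] using hQ (a + b) (by omega)
  · have h1' : StepsN P a ((M.wk (S.arity c.1)).subst (v.ext W K True).term) (.con c.1 W) := by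
      rwa [Valuation.ext_term, Term.wk_subst_ext]
    convert h1'.pair hcW h2 using 1
    simp only [Term.pair, Term.subst]
    congr 1
    funext i
    split <;> rfl
  · refine Inh.con fun i => ?_
    by_cases hi : i.val = 0
    · simp only [hi, if_true]
      exact Inh.con fun i => hB i
    · simp only [hi, if_false]
      exact hA

theorem satConcl_fix {n : ℕ} {v : Valuation S n} {Γ : Env S n} {M : Term S (n + 1)}
    {A : Ty S} (hv : Models P C K τ v Γ)
    (ih : ∀ v : Valuation S (n + 1),
      Models P C K τ v (insert (.typing (.var (Fin.natAdd n 0)) A) (Γ.wk 1)) →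
      SatConcl P C K τ v (some (M, A))) :
    SatConcl P C K τ v (some (.fix M, A)) := by
  refine .not_var (fun x => by simp) fun k hk hb => ?_
  -- Unrolling costs one step, so at level `k + 1` the recursion variable may stand for the fixpoint
  -- itself, typed only up to `k`.
  induction k with
  | zero => exact safe_zero _ _
  | succ k ihk =>
    have hs := ihk (by omega) (Below.anti hb (by omega))
    have hm := (hv.wk (V := fun _ : Fin 1 => (Term.fix M).subst v.term) (b := k) (p := False)
      (fun h => h.elim) fun _ => hs.subEq (Or.inr .ok)).insert
      (φ := .typing (.var (Fin.natAdd n 0)) A)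
      (Or.inr (Or.inl ⟨_, rfl, by simp, by simpa using hs⟩))
    have := (ih _ hm).1 k (by omega) (Below.of_liftPred hb (by omega) le_rfl _ _)
    rw [Valuation.ext_term, ← Term.inst_subst_liftSubst] at this
    exact .of_step .fix this

/-- Soundness of the rules with respect to the interpretation. -/
theorem Der.satConcl (hC : ConsistentConstr C) {n : ℕ} {Γ : Env S n} {Δ : Concl S n}
    (h : Der Γ Δ) (v : Valuation S n) (hv : Models P C K τ v Γ) : SatConcl P C K τ v Δ := by
  induction h with
  | varK x =>
    exact ⟨fun k _ hk => (hv.safe x).anti hk, fun y hy _ => .ok _⟩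
  | @gvar n Γ f T σ hf hc =>
    refine .not_var (fun x => by simp) fun k hk _ => ?_
    rcases hf with hf | ⟨A, hA, rfl, hf⟩
    · have := hv.sat _ hf (fun a => (σ a).subst τ) fun p hp => by
        rw [← Ty.subst_subst, ← Ty.subst_subst]
        exact hv.sub (hc p hp)
      rw [Ty.subst_subst]
      exact this.anti hk
    · change Safe P C k (.glob f) ((A.subst σ).subst τ)
      -- The identifier typing may be an ordinary formula with a closed monotype, on which all type
      -- substitutions agree.
      rw [Ty.subst_subst, Ty.subst_of_fv_eq_empty hA _ τ]
      rcases hv.sat _ hf with ⟨j, V, _, _, hN, hV, hA⟩ | ⟨x, hx, _⟩ | ⟨g, hg, hs⟩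
      · exact .of_refl hN hV hA k
      · cases hx
      · cases hg
        exact hs.anti hk
  | lvar hx => exact satConcl_var (hv.value _) (hv.sat _ hx)
  | subL hs _ ih => exact ih v (hv.tail.insert (hv.head.sub (hv.tail.sub hs)))
  | subR hs _ ih =>
    exact ⟨fun k hk hM => ((ih v hv).1 k hk hM).subEq (Or.inr (hv.sub hs)),
      fun x hx hn => .sub (hv.sub hs) ((ih v hv).2 x hx hn)⟩
  | absR _ ih => exact satConcl_lam_arr hv ih
  | abnR _ ih => exact satConcl_lam_nec hv ih
  | appL _ _ ihM ihN =>
    exact ihN v (hv.tail.insert (Or.inl (evalsTo_app_arg hC (ihM v hv.tail)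
      (hv.head.evalsTo (fun x => by simp) fun f => by simp))))
  | appR _ _ ihM ihN =>
    exact .not_var (fun x => by simp) fun k hk hb =>
      ((ihM v hv).1 k hk hb.1).app hC ((ihN v hv).1 k hk hb.2)
  | cnsL hc i _ ih =>
    obtain ⟨j, V, hj, hb, hs, hV, hA⟩ := hv.head.evalsTo (fun x => by simp) fun f => by simp
    obtain ⟨W, rfl, hW⟩ := hs.con_value hV
    obtain ⟨hWi, l, hl, hsi⟩ := hW i
    obtain ⟨d, W', heq, hW'⟩ := Inh.sum_inv hC hA
    obtain ⟨rfl, hWW⟩ := Term.con.inj heq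
    cases eq_of_heq hWW
    exact ih v (hv.tail.insert (Or.inl ⟨l, _, by omega, Below.anti (hb i) (by omega), hsi, hWi,
      hW' i⟩))
  | cnsR _ ih =>
    exact .not_var (fun x => by simp) fun k hk hb =>
      Safe.con fun i => (ih i v hv).1 k hk (hb i)
  | mchR _ _ ihM ihQ => exact satConcl_mtch hC hv (ihM v hv) ihQ
  | mchL _ _ ih ih' =>
    exact satConcl_of_evalsTo_mtch hv.tail
      (hv.head.evalsTo (fun x => by simp) fun f => by simp) ih ih'
  | fixR _ ih => exact satConcl_fix hv ih
  | cnsK i _ ih =>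
    obtain ⟨j, V, hj, hb, hs, hV, hA⟩ := hv.head.evalsTo (fun x => by simp) fun f => by simp
    obtain ⟨W, rfl, hW⟩ := hs.con_value hV
    obtain ⟨hWi, l, hl, hsi⟩ := hW i
    exact ih v (hv.tail.insert (Or.inl ⟨l, W i, by omega, Below.anti (hb i) (by omega), hsi, hWi,
      .ok _⟩))
  | funK _ ih =>
    obtain ⟨j, V, hj, hb, hs, hV, hA⟩ := hv.head.evalsTo (fun x => by simp) fun f => by simp
    obtain ⟨Q, W, a, b, c, h1, _, _, _, rfl⟩ := hs.app_value hV
    -- Every abstraction has type `Ok ⤚ A` in the sense of `Refl`; that generator exists for this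
    -- rule.
    exact ih v (hv.tail.insert (Or.inl ⟨a, .lam Q, by omega, Below.anti hb.1 (by omega), h1,
      .lam Q, .nec rfl⟩))
  | cnsDArr =>
    obtain ⟨j, V, hj, hb, hs, hV, hA⟩ := hv.head.evalsTo (fun x => by simp) fun f => by simp
    obtain ⟨W, rfl, _⟩ := hs.con_value hV
    obtain ⟨_, _, _, h, _⟩ := Inh.arr_inv hC hA
    cases h
  | cnsDNec =>
    obtain ⟨j, V, hj, hb, hs, hV, hA⟩ := hv.head.evalsTo (fun x => by simp) fun f => by simp
    obtain ⟨W, rfl, _⟩ := hs.con_value hV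
    obtain ⟨_, _, _, h, _⟩ := Inh.nec_inv hC hA
    cases h
  | cnsDSum hc =>
    obtain ⟨j, V, hj, hb, hs, hV, hA⟩ := hv.head.evalsTo (fun x => by simp) fun f => by simp
    obtain ⟨W, rfl, _⟩ := hs.con_value hV
    obtain ⟨d, _, h, _⟩ := Inh.sum_inv hC hA
    obtain ⟨rfl, _⟩ := Term.con.inj h
    exact (hc d.2).elim
  | absD =>
    obtain ⟨j, V, hj, hb, hs, hV, hA⟩ := hv.head.evalsTo (fun x => by simp) fun f => by simp
    obtain rfl := hs.eq_of_value (.lam _)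
    obtain ⟨_, _, h, _⟩ := Inh.sum_inv hC hA
    cases h

end

/-! ### Top-level definitions -/

/-- The valuation of no variables. -/
def Valuation.empty : Valuation S 0 where
  term := Fin.elim0
  bound := Fin.elim0
  nec := Fin.elim0

/-- Since `τ` fixes the type variables of the constraints, these are kept verbatim, and only the
identifier typings remain to be supplied. -/
theorem Models.of_topLevel {P : Program S} {Γ : Env S 0} (hΓ : TopLevelEnv Γ) {K : ℕ}
    {τ : ℕ → Ty S} (hτ : ∀ a ∈ constrFv Γ.constrs, τ a = .var a)
    (hg : ∀ f T, Γ.HasIdent f T → ∀ σ : ℕ → Ty S,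
      (∀ p ∈ T.constrs, Sub Γ.constrs (p.1.subst σ) (p.2.subst σ)) →
      Safe P Γ.constrs K (.glob f) (T.body.subst σ)) :
    Models P Γ.constrs K τ .empty Γ := by
  refine ⟨fun x => x.elim0, fun x => x.elim0, fun φ hφ => ?_⟩
  rcases hΓ.shape φ hφ with ⟨A, B, rfl⟩ | ⟨f, T, rfl⟩ | ⟨f, A, hA, rfl⟩
  · have hp : (A, B) ∈ Γ.constrs := hφ
    have hfv : ∀ a ∈ A.fv ∪ B.fv, τ a = .var a := fun a ha =>
      hτ a (Set.mem_iUnion₂.2 ⟨(A, B), hp, ha⟩)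
    change Sub _ _ _
    rw [Ty.subst_congr (τ := .var) fun a ha => hfv a (Or.inl ha),
      Ty.subst_congr (A := B) (τ := .var) fun a ha => hfv a (Or.inr ha), Ty.subst_var,
      Ty.subst_var]
    exact .id hp
  · exact hg f T (Or.inl hφ)
  · exact Or.inr (Or.inr ⟨f, rfl, hg f (.mono A hA) (Or.inr ⟨A, hA, rfl, hφ⟩) τ
      (by simp [Scheme.mono])⟩)

theorem JustifiedProgram.safe {P : Program S} {Γ : Env S 0} (hP : JustifiedProgram P Γ)
    (hΓ : TopLevelEnv Γ) (hC : ConsistentEnv Γ) (K : ℕ) {f : ℕ} {T : Scheme S}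
    (hf : Γ.HasIdent f T) {σ : ℕ → Ty S}
    (hσ : ∀ p ∈ T.constrs, Sub Γ.constrs (p.1.subst σ) (p.2.subst σ)) :
    Safe P Γ.constrs K (.glob f) (T.body.subst σ) := by
  classical
  induction K generalizing f T σ with
  | zero => exact safe_zero _ _
  | succ K ih =>
    have hT := hP.justified f T hf
    obtain ⟨M, hM, hd⟩ := hT.der
    -- The derivation mentions both the scheme's variables and those of the environment. Freshness
    -- keeps them apart, so one substitution can instantiate the former and fix the latter.
    let τ : ℕ → Ty S := fun a => if a ∈ T.vars then σ a else .var a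
    have hτσ : ∀ A : Ty S, A.fv ⊆ T.vars → A.subst τ = A.subst σ := fun A hA =>
      Ty.subst_congr fun a ha => if_pos (hA ha)
    have hm : Models P Γ.constrs K τ .empty Γ := by
      -- Safety of all identifiers at level `K` makes the body safe at `K`; the unfolding step
      -- raises this to `K + 1`, which also handles recursive definitions.
      refine .of_topLevel hΓ (fun a ha => if_neg fun h => ?_) fun f T hf σ hσ => ih hf hσ
      exact Set.disjoint_left.1 hT.fresh h ha
    have hm' : Models P Γ.constrs K τ .empty
        (Γ ∪ {φ | ∃ p ∈ T.constrs, φ = Formula.sub p.1 p.2}) := by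
      refine ⟨hm.value, hm.safe, ?_⟩
      rintro φ (hφ | ⟨p, hp, rfl⟩)
      · exact hm.sat φ hφ
      · have hfv : p.1.fv ∪ p.2.fv ⊆ T.vars := fun a ha =>
          T.closed (Or.inl (Set.mem_iUnion₂.2 ⟨p, hp, ha⟩))
        change Sub _ _ _
        rw [hτσ _ (Set.subset_union_left.trans hfv), hτσ _ (Set.subset_union_right.trans hfv)]
        exact hσ p hp
    have hs := (hd.satConcl hC _ hm').1 K le_rfl (Term.FVAll.of_forall fun x => x.elim0)
    rw [Term.subst_closed, hτσ _ (Set.subset_union_right.trans T.closed)] at hs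
    refine .of_step (.delta hM) ?_
    rwa [Term.ren_closed]

end TwoSided

theorem mainTheorem5 (S : TwoSided.Signature) (P : TwoSided.Program S) (Γ : TwoSided.Env S 0)
    (hΓ : TwoSided.TopLevelEnv Γ) (hcons : TwoSided.ConsistentEnv Γ)
    (hP : TwoSided.JustifiedProgram P Γ) (M : TwoSided.Term S 0) :
    (TwoSided.WellTyped Γ M → ¬ TwoSided.GoesWrong P M) ∧
      (TwoSided.IllTyped Γ M → ¬ TwoSided.Evaluates P M) := by
  have hm : ∀ K, TwoSided.Models P Γ.constrs K .var .empty Γ := fun K =>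
    .of_topLevel hΓ (fun a _ => rfl) fun f T hf σ hσ => hP.safe hΓ hcons K hf hσ
  constructor
  · intro h
    refine TwoSided.not_goesWrong_of_safe (C := Γ.constrs) (A := .ok) fun k => ?_
    have := (h.satConcl hcons _ (hm k)).1 k le_rfl (TwoSided.Term.FVAll.of_forall fun x => x.elim0)
    rwa [TwoSided.Term.subst_closed] at this
  · rintro h ⟨V, hMV, hV⟩
    obtain ⟨j, hj⟩ := hMV.exists_stepsN
    -- The bound `j + 1` is the least that admits an evaluation of length `j`. With the right-hand
    -- side empty, truth of the left is a contradiction.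
    refine h.satConcl hcons _ ((hm (j + 1)).insert (Or.inl ⟨j, V, j.lt_succ_self,
      TwoSided.Term.FVAll.of_forall fun x => x.elim0, ?_, hV, .ok V⟩))
    rwa [TwoSided.Term.subst_closed]
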